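/- Let $(\Omega,\mathcal F,(\mathcal F_t)_{t\ge 0},P)$ be a filtered probability space satisfying the usual conditions. A process $X$ is called *locally bounded* if there are stopping times $T_n$ increasing almost surely to infinity such that each $X^{T_n}1_{(T_n>0)}$ is bounded. Let $N=(N^1,\dots,N^d)$ be a nonexplosive $d$-dimensional counting process (adapted, càdlàg and piecewise constant with jumps of size one, no two coordinates jumping at the same time), and let $\lambda$ and $\mu$ be $d$-dimensional processes whose coordinates are nonnegative, predictable and locally bounded. Assume that $N$ has intensity $\lambda$, that is, $M^i_t=N^i_t-\int_0^t\lambda^i_s\,ds$ is a local martingale for each $i$. Put $\gamma^i_t=\mu^i_t/\lambda^i_t$, with the convention $0/0=1$, and assume that $\mu$ is $\lambda$-compatible: $\mu^i_t(\omega)=0$ whenever $\lambda^i_t(\omega)=0$, and each $\gamma^i$ is locally bounded. Put $H^i=\gamma^i-1$ and $(H\cdot M)_t=\sum_{i=1}^d\int_0^t H^i_s\,dM^i_s$, and let $\mathcal E(H\cdot M)$ be its Doléans-Dade exponential, that is, the càdlàg adapted solution $Z$, unique up to indistinguishability, of $Z_t=1+\int_0^t Z_{s-}\,d(H\cdot M)_s$.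 Assume that for every $i\le d$, almost surely, the set $\{t\ge 0:\mu^i_t=0\}$ has Lebesgue measure zero. Then: 1. Almost surely, $\mathcal E(H\cdot M)_t>0$ for all $t\ge 0$. 2. If $T$ is an almost surely finite stopping time such that the stopped process $\mathcal E(H\cdot M)^T$ is a uniformly integrable martingale, then the measure $Q_T$ with density $\mathcal E(H\cdot M)_T$ with respect to $P$ is a probability measure equivalent to $P$. Likewise, if $\mathcal E(H\cdot M)$ is a martingale, then for every $t\ge 0$ the measure $Q_t$ with density $\mathcal E(H\cdot M)_t$ with respect to $P$ is a probability measure equivalent to $P$. -/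

import Mathlib

open MeasureTheory ProbabilityTheory Filter Set
open scoped NNReal ENNReal Topology

noncomputable section

namespace CountingExp

variable {Ω : Type*} {mΩ : MeasurableSpace Ω}

/-! ### Paths and pathwise integration -/

/-- Lebesgue measure on the time axis `[0, ∞)`. -/
def lebesgue : Measure ℝ≥0 := (volume : Measure ℝ).comap ((↑) : ℝ≥0 → ℝ)

/-- A càdlàg path: right-continuous, with (finite) limits from the left. -/
def IsCadlag (x : ℝ≥0 → ℝ) : Prop :=
  ∀ t, ContinuousWithinAt x (Ici t) t ∧ ∃ l, Tendsto x (𝓝[<] t) (𝓝 l)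

/-- The jump `Δx_t = x_t - x_{t-}` of a path (it is `0` at `t = 0`). -/
def jump (x : ℝ≥0 → ℝ) (t : ℝ≥0) : ℝ := x t - Function.leftLim x t

open scoped Classical in
/-- The Lebesgue-Stieltjes integral `∫_{(0,t]} f_s dx_s` of `f` with respect to a càdlàg path `x`
whose variation on `[0,t]` is finite, that is, the integral of `f` over `(0,t]` with respect to the
signed measure which gives mass `x_b - x_a` to each interval `(a,b]` contained in `(0,t]`. (It is
set to `0` where `x` has infinite variation on `[0,t]`.) -/
def stieltjesIntegral (f x : ℝ≥0 → ℝ) (t : ℝ≥0) : ℝ :=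
  if h : BoundedVariationOn (fun s => x (min s t)) univ then
    ∫ᵛ s in Ioc 0 t, f s ∂•h.vectorMeasure
  else 0

/-! ### Filtrations and processes -/

/-- The usual conditions: the filtration is right-continuous, and every `P`-null subset of `Ω`
belongs to `𝓕 0` (in particular the probability space is complete). -/
structure UsualConditions (𝓕 : Filtration ℝ≥0 mΩ) (P : Measure Ω) : Prop where
  rightContinuous : 𝓕.IsRightContinuous
  null_measurable : ∀ s : Set Ω, P s = 0 → MeasurableSet[𝓕 0] s

/-- `X` is locally bounded: there are stopping times `T n` increasing almost surely to infinity such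
that each `X^{T n} 1_{(T n > 0)}` is bounded. -/
def IsLocallyBounded (𝓕 : Filtration ℝ≥0 mΩ) (P : Measure Ω) (X : ℝ≥0 → Ω → ℝ) : Prop :=
  Locally (fun Y => ∃ C : ℝ, ∀ t ω, |Y t ω| ≤ C) 𝓕 X P

/-- `X` is a local martingale: there are stopping times `T n` increasing almost surely to infinity
such that each `X^{T n} 1_{(T n > 0)}` is a martingale with (almost surely) càdlàg paths. -/
def IsLocalMartingale (𝓕 : Filtration ℝ≥0 mΩ) (P : Measure Ω) (X : ℝ≥0 → Ω → ℝ) : Prop :=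
  Locally (fun Y => Martingale Y 𝓕 P ∧ ∀ᵐ ω ∂P, IsCadlag fun t => Y t ω) 𝓕 X P

/-- Each coordinate of the `d`-dimensional process `X` is nonnegative, predictable and locally
bounded. -/
structure IsNonnegPredictableLocallyBounded {d : ℕ} (𝓕 : Filtration ℝ≥0 mΩ) (P : Measure Ω)
    (X : Fin d → ℝ≥0 → Ω → ℝ) : Prop where
  nonneg : ∀ i t ω, 0 ≤ X i t ω
  predictable : ∀ i, IsStronglyPredictable 𝓕 (X i)
  locallyBounded : ∀ i, IsLocallyBounded 𝓕 P (X i)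

/-- A nonexplosive `d`-dimensional counting process: adapted, càdlàg and piecewise constant with
jumps of size one, such that no two coordinates jump at the same time. Piecewise constancy of a
path is expressed by the path being constant on some interval `[t, t + ε)` and on some
interval `(t - ε, t)`, for every `t`; by compactness this makes the number of jumps finite on
bounded intervals. -/
structure IsNonexplosiveCountingProcess {d : ℕ} (𝓕 : Filtration ℝ≥0 mΩ)
    (N : Fin d → ℝ≥0 → Ω → ℝ) : Prop where
  adapted : ∀ i, StronglyAdapted 𝓕 (N i)
  cadlag : ∀ i ω, IsCadlag fun t => N i t ω
  const_right : ∀ i ω t, ∀ᶠ s in 𝓝[≥] t, N i s ω = N i t ω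
  const_left : ∀ i ω t, ∃ c, ∀ᶠ s in 𝓝[<] t, N i s ω = c
  jump_size : ∀ i ω t, jump (fun s => N i s ω) t = 0 ∨ jump (fun s => N i s ω) t = 1
  no_common_jumps : ∀ i j, i ≠ j → ∀ ω t,
    jump (fun s => N i s ω) t = 0 ∨ jump (fun s => N j s ω) t = 0

/-- The process `M^i_t = N^i_t - ∫_0^t lam^i_s ds`. -/
def compensated {d : ℕ} (N lam : Fin d → ℝ≥0 → Ω → ℝ) (i : Fin d) (t : ℝ≥0) (ω : Ω) : ℝ :=
  N i t ω - ∫ s in Ioc 0 t, lam i s ω ∂lebesgue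

/-- The counting process `N` has intensity `lam`: each `N^i_t - ∫_0^t lam^i_s ds` is a local
martingale. -/
def HasIntensity {d : ℕ} (𝓕 : Filtration ℝ≥0 mΩ) (P : Measure Ω)
    (N lam : Fin d → ℝ≥0 → Ω → ℝ) : Prop :=
  ∀ i, IsLocalMartingale 𝓕 P (compensated N lam i)

open scoped Classical in
/-- `γ^i_t = mu^i_t / lam^i_t`, with the convention that zero divided by zero is one. -/
def ratio {d : ℕ} (lam mu : Fin d → ℝ≥0 → Ω → ℝ) (i : Fin d) (t : ℝ≥0) (ω : Ω) : ℝ :=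
  if mu i t ω = 0 ∧ lam i t ω = 0 then 1 else mu i t ω / lam i t ω

/-- `mu` is `lam`-compatible: `mu^i_t(ω) = 0` whenever `lam^i_t(ω) = 0`, and `γ` is locally
bounded. -/
structure IsCompatible {d : ℕ} (𝓕 : Filtration ℝ≥0 mΩ) (P : Measure Ω)
    (lam mu : Fin d → ℝ≥0 → Ω → ℝ) : Prop where
  zero_of_zero : ∀ i t ω, lam i t ω = 0 → mu i t ω = 0
  locallyBounded : ∀ i, IsLocallyBounded 𝓕 P (ratio lam mu i)

/-- The process `(H · M)_t = ∑ i, ∫_0^t H^i_s dM^i_s`, where `H^i = γ^i - 1` and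
`M^i = N^i - ∫ lam^i ds`. The paths of `M^i` have finite variation, so that the stochastic integral
of the predictable, locally bounded process `H^i` is the pathwise Lebesgue-Stieltjes integral. -/
def integralHM {d : ℕ} (N lam mu : Fin d → ℝ≥0 → Ω → ℝ) (t : ℝ≥0) (ω : Ω) : ℝ :=
  ∑ i, stieltjesIntegral (fun s => ratio lam mu i s ω - 1) (fun s => compensated N lam i s ω) t

/-- `Z` is (a version of) the Doléans-Dade exponential `𝓔(X)` of a semimartingale `X` with initial
value zero and paths of finite variation on compacts: the càdlàg adapted solution, unique up to
indistinguishability, of `Z_t = 1 + ∫_0^t Z_{s-} dX_s`. As `X` has paths of finite variation, the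
stochastic integral is the pathwise Lebesgue-Stieltjes integral. -/
structure IsDoleansDadeExponential (𝓕 : Filtration ℝ≥0 mΩ) (P : Measure Ω)
    (X Z : ℝ≥0 → Ω → ℝ) : Prop where
  adapted : StronglyAdapted 𝓕 Z
  cadlag : ∀ ω, IsCadlag fun t => Z t ω
  equation : ∀ᵐ ω ∂P, ∀ t,
    Z t ω = 1 + stieltjesIntegral (Function.leftLim fun s => Z s ω) (fun s => X s ω) t

/-- The measure with density `D` (a real random variable) with respect to `P`. -/
def changedMeasure (P : Measure Ω) (D : Ω → ℝ) : Measure Ω :=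
  P.withDensity fun ω => ENNReal.ofReal (D ω)

/-- `Q` is a probability measure which is equivalent to `P` (it has the same null sets). -/
def IsEquivProbability (Q P : Measure Ω) : Prop :=
  IsProbabilityMeasure Q ∧ Q ≪ P ∧ P ≪ Q

end CountingExp

end

/-!
The argument is pathwise up to one probabilistic fact.

Along a fixed path, let `ν i` be the jump measure of `N^i`, so that `M^i` is the difference of
`ν i` and of the measure with density `lam^i`. A Stieltjes integral against a difference of two
measures is the difference of the integrals (`stieltjesIntegral_eq_sub`). Applied to `H · M`, and
then to the equation of `Z`, this gives (`stieltjesIntegral_eq_sum`)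

`Z_t = 1 + ∑ i, (∫_(0,t] Z_{s-} (γ^i_s - 1) dν i - ∫_(0,t] Z_{s-} (γ^i_s - 1) lam^i_s ds)`.

Between jumps this is a linear equation with bounded coefficients, whose solution cannot reach zero;
at a jump of `N^i` the equation reads `Z_t = γ^i_t Z_{t-}`. Hence `Z` stays positive as soon as
`γ^i > 0` at every jump of `N^i` (`pos_of_linear_equation`, `exponential_pos_of_path`).

The probabilistic fact is that `γ^i` almost surely does not vanish at the jumps of `N^i`. The set
`{γ^i = 0}` is predictable and contained in `{mu^i = 0}`, so that its sections are Lebesgue-null.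
Up to a localizing time, the expected number of jumps of `N^i` in a predictable set is the
expectation of the integral of `lam^i` over that set (`lintegral_jumps_predictable`): on the
rectangles which generate the predictable sets this is optional stopping for the càdlàg martingale
`M^i` (`integral_stopped_of_cadlag_martingale`), and the π-λ theorem gives the rest. So a
predictable set with null sections contains almost surely no jump (`ae_jumps_avoid_predictable`).

As the densities are positive, the changed measures are equivalent to `P` once they have mass one.
For a martingale `Z` this is `E Z_t = E Z_0 = 1`; at a finite stopping time `T` it follows from
`E Z_{T ∧ n} = 1`, since `Z_{T ∧ n}` converges to `Z_T` in `L¹` by uniform integrability.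
-/

namespace CountingExp

/-! ### Stieltjes integrals against differences of measures -/

lemma measureReal_Iic_rightContinuous (m : Measure ℝ≥0) [IsFiniteMeasure m] (a : ℝ≥0) :
    ContinuousWithinAt (fun s => m.real (Iic s)) (Ioi a) a := by
  have h := tendsto_measure_biInter_gt (μ := m) (s := fun r : ℝ≥0 => Iic r) (a := a)
    (fun r _ => measurableSet_Iic.nullMeasurableSet) (fun i j _ hij => Iic_subset_Iic.2 hij)
    ⟨a + 1, by simp, measure_ne_top _ _⟩
  have h2 : (⋂ r > a, Iic r) = Iic a := by
    ext x; simp only [gt_iff_lt, mem_iInter, mem_Iic]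
    exact ⟨fun h => le_of_forall_gt_imp_ge_of_dense h, fun h r hr => h.trans hr.le⟩
  rw [h2] at h
  exact (ENNReal.tendsto_toReal (measure_ne_top _ _)).comp h

lemma boundedVariationOn_of_eq_sub {m₁ m₂ : Measure ℝ≥0} [IsFiniteMeasure m₁] [IsFiniteMeasure m₂]
    {g : ℝ≥0 → ℝ} {c : ℝ} (hg : ∀ s, g s = c + m₁.real (Iic s) - m₂.real (Iic s)) :
    BoundedVariationOn g univ := by
  have hG : BoundedVariationOn (fun s => (m₁ + m₂).real (Iic s)) univ := by
    refine MonotoneOn.boundedVariationOn (C := (m₁ + m₂).real univ) ?_ ?_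
    · intro a _ b _ hab
      exact measureReal_mono (Iic_subset_Iic.2 hab)
    · intro a _
      rw [abs_of_nonneg measureReal_nonneg]
      exact measureReal_mono (subset_univ _)
  refine ne_top_of_le_ne_top hG (iSup_le ?_)
  rintro ⟨n, ⟨u, hu, us⟩⟩
  refine le_trans (Finset.sum_le_sum fun i _ => ?_) (eVariationOn.sum_le (n := n) hu us)
  have hle : u i ≤ u (i + 1) := hu (Nat.le_succ i)
  have h₁ : m₁.real (Iic (u i)) ≤ m₁.real (Iic (u (i + 1))) :=
    measureReal_mono (Iic_subset_Iic.2 hle)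
  have h₂ : m₂.real (Iic (u i)) ≤ m₂.real (Iic (u (i + 1))) :=
    measureReal_mono (Iic_subset_Iic.2 hle)
  rw [edist_dist, edist_dist]
  refine ENNReal.ofReal_le_ofReal ?_
  rw [Real.dist_eq, Real.dist_eq, hg, hg, measureReal_add_apply, measureReal_add_apply]
  refine le_trans ?_ (le_abs_self _)
  rw [abs_le]
  constructor <;> linarith

/-- The signed measure of a path `c + m₁ [0, s] - m₂ [0, s]`, where `m₁` and `m₂` give no mass to
the origin, is `m₁ - m₂`. -/
lemma vectorMeasure_eq_sub (m₁ m₂ : Measure ℝ≥0) [IsFiniteMeasure m₁] [IsFiniteMeasure m₂]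
    (h₁ : m₁ {0} = 0) (h₂ : m₂ {0} = 0) {g : ℝ≥0 → ℝ} {c : ℝ}
    (hg : ∀ s, g s = c + m₁.real (Iic s) - m₂.real (Iic s)) (h : BoundedVariationOn g univ) :
    h.vectorMeasure = m₁.toSignedMeasure - m₂.toSignedMeasure := by
  have hbot : (atBot : Filter ℝ≥0) = pure 0 := OrderBot.atBot_eq ℝ≥0
  have hI0 : (Iic 0 : Set ℝ≥0) = {0} := by ext x; simp
  have hlim0 : limUnder atBot g = c := by
    refine Tendsto.limUnder_eq ?_
    rw [hbot, tendsto_pure_left]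
    intro s hs
    have : g 0 = c := by simp [hg, hI0, Measure.real, h₁, h₂]
    rw [this]; exact mem_of_mem_nhds hs
  have hlim (m : Measure ℝ≥0) [IsFiniteMeasure m] :
      Tendsto (fun s => m.real (Iic s)) atTop (𝓝 (m.real univ)) := by
    have := tendsto_measure_iUnion_atTop (μ := m) (s := fun r : ℝ≥0 => Iic r)
      (fun i j hij => Iic_subset_Iic.2 hij)
    rw [iUnion_Iic] at this
    exact (ENNReal.tendsto_toReal (measure_ne_top _ _)).comp this
  have hlim1 : limUnder atTop g = c + m₁.real univ - m₂.real univ := by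
    refine Tendsto.limUnder_eq ?_
    rw [show g = _ from funext hg]
    exact ((tendsto_const_nhds.add (hlim m₁))).sub (hlim m₂)
  have hr (a : ℝ≥0) : g.rightLim a = g a := by
    refine ContinuousWithinAt.rightLim_eq ?_
    rw [show g = _ from funext hg, ← continuousWithinAt_Ioi_iff_Ici]
    exact ((continuousWithinAt_const (b := c)).add (measureReal_Iic_rightContinuous m₁ a)).sub
      (measureReal_Iic_rightContinuous m₂ a)
  refine VectorMeasure.ext_of_generateFrom (range Iic) ?_
    (by rw [← borel_eq_generateFrom_Iic]; exact BorelSpace.measurable_eq) isPiSystem_Iic ?_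
  · rintro _ ⟨a, rfl⟩
    rw [h.vectorMeasure_Iic, hlim0, hr, hg, sub_apply,
      Measure.toSignedMeasure_apply_measurable measurableSet_Iic,
      Measure.toSignedMeasure_apply_measurable measurableSet_Iic]
    ring
  · rw [h.vectorMeasure_univ, hlim0, hlim1, sub_apply,
      Measure.toSignedMeasure_apply_measurable .univ,
      Measure.toSignedMeasure_apply_measurable .univ]
    ring

/-- The Stieltjes integral against a path which is a difference of distribution functions of
measures is the difference of the integrals against the measures. -/
theorem stieltjesIntegral_eq_sub {ν₁ ν₂ : Measure ℝ≥0} {t : ℝ≥0}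
    (h₁ : ν₁ (Ioc 0 t) ≠ ∞) (h₂ : ν₂ (Ioc 0 t) ≠ ∞) {x : ℝ≥0 → ℝ} {c : ℝ}
    (hx : ∀ s ≤ t, x s = c + ν₁.real (Ioc 0 s) - ν₂.real (Ioc 0 s)) {f : ℝ≥0 → ℝ}
    (hf₁ : IntegrableOn f (Ioc 0 t) ν₁) (hf₂ : IntegrableOn f (Ioc 0 t) ν₂) :
    stieltjesIntegral f x t = ∫ s in Ioc 0 t, f s ∂ν₁ - ∫ s in Ioc 0 t, f s ∂ν₂ := by
  set m₁ := ν₁.restrict (Ioc 0 t) with hm₁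
  set m₂ := ν₂.restrict (Ioc 0 t) with hm₂
  have : IsFiniteMeasure m₁ := ⟨by simpa [hm₁] using h₁.lt_top⟩
  have : IsFiniteMeasure m₂ := ⟨by simpa [hm₂] using h₂.lt_top⟩
  have hIic (s : ℝ≥0) : Iic s ∩ Ioc 0 t = Ioc 0 (min s t) := by
    ext u; simp only [mem_inter_iff, mem_Iic, mem_Ioc, le_min_iff]; tauto
  have hg (s : ℝ≥0) : x (min s t) = c + m₁.real (Iic s) - m₂.real (Iic s) := by
    rw [hx _ (min_le_right _ _), hm₁, hm₂, measureReal_restrict_apply measurableSet_Iic,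
      measureReal_restrict_apply measurableSet_Iic, hIic]
  have h : BoundedVariationOn (fun s => x (min s t)) univ := by
    exact boundedVariationOn_of_eq_sub hg
  have h0 (ν : Measure ℝ≥0) : (ν.restrict (Ioc 0 t)) {0} = 0 := by
    rw [Measure.restrict_apply (measurableSet_singleton 0)]; simp
  have hv := vectorMeasure_eq_sub m₁ m₂ (h0 _) (h0 _) hg h
  have hi (m : Measure ℝ≥0) [IsFiniteMeasure m] : m.toSignedMeasure.integral f
      (ContinuousLinearMap.lsmul ℝ ℝ) = ∫ s, f s ∂m := by
    have := VectorMeasure.integral_toSignedMeasure (μ := m) (f := f)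
    rw [← this]
    congr 1
    ext; simp
  rw [stieltjesIntegral, dif_pos h, hv]
  have hr : (m₁.toSignedMeasure - m₂.toSignedMeasure).restrict (Ioc 0 t) =
      m₁.toSignedMeasure - m₂.toSignedMeasure := by
    rw [VectorMeasure.restrict_sub]
    rw [VectorMeasure.restrict_toSignedMeasure measurableSet_Ioc,
      VectorMeasure.restrict_toSignedMeasure measurableSet_Ioc]
    simp only [hm₁, hm₂, Measure.restrict_restrict measurableSet_Ioc, inter_self]
  rw [hr, VectorMeasure.integral_sub_vectorMeasure, hi, hi]
  · rw [VectorMeasure.Integrable, Measure.variation_toSignedMeasure]; exact hf₁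
  · rw [VectorMeasure.Integrable, Measure.variation_toSignedMeasure]; exact hf₂

lemma integral_withDensity_ofReal {κ : Measure ℝ≥0} {g f : ℝ≥0 → ℝ} (hg : Integrable g κ)
    (hf : Measurable f) {C : ℝ} (hC : ∀ᵐ s ∂κ, |f s| ≤ C) :
    Integrable f (κ.withDensity fun s => ENNReal.ofReal (g s)) ∧
      ∫ s, f s ∂(κ.withDensity fun s => ENNReal.ofReal (g s)) = ∫ s, max (g s) 0 * f s ∂κ := by
  have hm : AEMeasurable (fun s => ENNReal.ofReal (g s)) κ :=
    hg.aestronglyMeasurable.aemeasurable.ennreal_ofReal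
  have hlt : ∀ᵐ s ∂κ, ENNReal.ofReal (g s) < ⊤ := ae_of_all _ fun _ => ENNReal.ofReal_lt_top
  constructor
  · rw [integrable_withDensity_iff_integrable_smul₀' hm hlt]
    simp only [ENNReal.toReal_ofReal', smul_eq_mul]
    exact hg.pos_part.mul_bdd hf.aestronglyMeasurable hC
  · rw [integral_withDensity_eq_integral_toReal_smul₀ hm hlt]
    simp only [ENNReal.toReal_ofReal', smul_eq_mul]

lemma setIntegral_sum_withDensity {ι : Type*} [Fintype ι] {ν : ι → Measure ℝ≥0}
    {g : ι → ℝ≥0 → ℝ} {A : Set ℝ≥0} (hA : MeasurableSet A) (hg : ∀ j, IntegrableOn (g j) A (ν j))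
    {f : ℝ≥0 → ℝ} (hf : Measurable f) {C : ℝ} (hC : ∀ s ∈ A, |f s| ≤ C) :
    IntegrableOn f A (∑ j, (ν j).withDensity fun s => ENNReal.ofReal (g j s)) ∧
      ∫ s in A, f s ∂(∑ j, (ν j).withDensity fun s => ENNReal.ofReal (g j s)) =
        ∑ j, ∫ s in A, max (g j s) 0 * f s ∂ν j := by
  have h (j : ι) := integral_withDensity_ofReal (hg j) hf (ae_restrict_of_forall_mem hA hC)
  have hr : (∑ j, (ν j).withDensity fun s => ENNReal.ofReal (g j s)).restrict A =
      ∑ j, ((ν j).restrict A).withDensity fun s => ENNReal.ofReal (g j s) := by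
    simp_rw [← restrict_withDensity hA]
    exact map_sum (Measure.restrictₗ A) _ _
  rw [IntegrableOn, hr]
  refine ⟨integrable_finsetSum_measure.2 fun j _ => (h j).1, ?_⟩
  rw [integral_finsetSum_measure fun j _ => (h j).1]
  exact Finset.sum_congr rfl fun j _ => (h j).2

/-- If a path is a finite sum of indefinite integrals with respect to measures, then so is the
Stieltjes integral against it: `dx = ∑ j, g j dν j` gives `∫ f dx = ∑ j, ∫ f g j dν j`. -/
theorem stieltjesIntegral_eq_sum {ι : Type*} [Fintype ι] {ν : ι → Measure ℝ≥0}
    {g : ι → ℝ≥0 → ℝ} {t : ℝ≥0} (hg : ∀ j, IntegrableOn (g j) (Ioc 0 t) (ν j))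
    {x : ℝ≥0 → ℝ} {c : ℝ} (hx : ∀ s ≤ t, x s = c + ∑ j, ∫ u in Ioc 0 s, g j u ∂ν j)
    {f : ℝ≥0 → ℝ} (hf : Measurable f) {C : ℝ} (hC : ∀ s ∈ Ioc 0 t, |f s| ≤ C) :
    stieltjesIntegral f x t = ∑ j, ∫ s in Ioc 0 t, g j s * f s ∂ν j := by
  -- integrate separately against the positive and the negative parts of the densities
  set ν₁ : Measure ℝ≥0 := ∑ j, (ν j).withDensity fun s => ENNReal.ofReal (g j s) with hν₁
  set ν₂ : Measure ℝ≥0 := ∑ j, (ν j).withDensity fun s => ENNReal.ofReal (- g j s) with hν₂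
  have key {f : ℝ≥0 → ℝ} (hf : Measurable f) {C : ℝ} {s : ℝ≥0} (hs : s ≤ t)
      (hC : ∀ u ∈ Ioc 0 s, |f u| ≤ C) :
      IntegrableOn f (Ioc 0 s) ν₁ ∧ IntegrableOn f (Ioc 0 s) ν₂ ∧
        ∫ u in Ioc 0 s, f u ∂ν₁ - ∫ u in Ioc 0 s, f u ∂ν₂ =
          ∑ j, ∫ u in Ioc 0 s, g j u * f u ∂ν j := by
    have hg' (j) : IntegrableOn (g j) (Ioc 0 s) (ν j) := (hg j).mono_set (Ioc_subset_Ioc_right hs)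
    have e₁ := setIntegral_sum_withDensity measurableSet_Ioc hg' hf hC
    have e₂ := setIntegral_sum_withDensity measurableSet_Ioc (fun j => (hg' j).neg) hf hC
    refine ⟨e₁.1, e₂.1, ?_⟩
    have e₁' := e₁.2
    have e₂' := e₂.2
    simp only [Pi.neg_apply] at e₂'
    rw [hν₁, hν₂, e₁', e₂', ← Finset.sum_sub_distrib]
    refine Finset.sum_congr rfl fun j _ => ?_
    have hb : ∀ᵐ u ∂(ν j).restrict (Ioc 0 s), |f u| ≤ C :=
      ae_restrict_of_forall_mem measurableSet_Ioc hC
    rw [← integral_sub ((hg' j).pos_part.mul_bdd hf.aestronglyMeasurable hb)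
      ((hg' j).neg_part.mul_bdd hf.aestronglyMeasurable hb)]
    refine integral_congr_ae (ae_of_all _ fun u => ?_)
    rcases le_total 0 (g j u) with h | h
    · simp [max_eq_left h, max_eq_right (neg_nonpos.2 h)]
    · simp [max_eq_right h, max_eq_left (neg_nonneg.2 h)]
  have hfin {s : ℝ≥0} (hs : s ≤ t) := key (f := fun _ => 1) measurable_const hs (C := 1) (by simp)
  have h₁ : ν₁ (Ioc 0 t) ≠ ∞ := by
    have := (hfin le_rfl).1
    rw [IntegrableOn, integrable_const_iff] at this
    exact LT.lt.ne (by simpa [isFiniteMeasure_iff] using this)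
  have h₂ : ν₂ (Ioc 0 t) ≠ ∞ := by
    have := (hfin le_rfl).2.1
    rw [IntegrableOn, integrable_const_iff] at this
    exact LT.lt.ne (by simpa [isFiniteMeasure_iff] using this)
  have hk := key hf le_rfl hC
  rw [stieltjesIntegral_eq_sub h₁ h₂ (c := c) (fun s hs => ?_) hk.1 hk.2.1, hk.2.2]
  have := (hfin hs).2.2
  simp only [integral_const, measureReal_restrict_apply_univ, smul_eq_mul, mul_one] at this
  rw [hx s hs, ← this]
  ring

/-! ### Lebesgue measure on the half-line -/

lemma lebesgue_Ioc (a b : ℝ≥0) : lebesgue (Ioc a b) = ENNReal.ofReal (b - a) := by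
  rw [lebesgue, NNReal.isClosedEmbedding_coe.measurableEmbedding.comap_apply, NNReal.image_coe_Ioc,
    Real.volume_Ioc]

lemma lebesgue_Ioc_ne_top (a b : ℝ≥0) : lebesgue (Ioc a b) ≠ ∞ := by simp [lebesgue_Ioc]

lemma lebesgue_real_Ioc {a b : ℝ≥0} (h : a ≤ b) : lebesgue.real (Ioc a b) = b - a := by
  rw [Measure.real, lebesgue_Ioc, ENNReal.toReal_ofReal (sub_nonneg.2 (NNReal.coe_le_coe.2 h))]

instance : IsLocallyFiniteMeasure lebesgue := by
  refine ⟨fun x => ⟨Iio (x + 1), Iio_mem_nhds (by simp), ?_⟩⟩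
  have : ((↑) : ℝ≥0 → ℝ) '' Iio (x + 1) ⊆ Icc 0 (x + 1) := by
    rintro _ ⟨y, hy, rfl⟩
    exact ⟨y.2, by exact_mod_cast le_of_lt hy⟩
  rw [lebesgue, NNReal.isClosedEmbedding_coe.measurableEmbedding.comap_apply]
  exact (measure_mono this).trans_lt (by simp)

/-! ### Càdlàg paths -/

lemma IsCadlag.tendsto_leftLim {x : ℝ≥0 → ℝ} (hx : IsCadlag x) (t : ℝ≥0) :
    Tendsto x (𝓝[<] t) (𝓝 (Function.leftLim x t)) :=
  tendsto_leftLim_of_tendsto (hx t).2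

lemma nhdsLT_neBot_of_pos {t : ℝ≥0} (ht : 0 < t) : (𝓝[<] t).NeBot :=
  nhdsLT_neBot_of_exists_lt ⟨0, ht⟩

lemma IsCadlag.exists_bound {x : ℝ≥0 → ℝ} (hx : IsCadlag x) (t : ℝ≥0) :
    ∃ C, ∀ s ≤ t, |x s| ≤ C := by
  have hp : ∃ C, ∀ s ∈ Icc 0 t, |x s| ≤ C := by
    refine isCompact_Icc.induction_on (p := fun A => ∃ C, ∀ s ∈ A, |x s| ≤ C) ⟨0, by simp⟩ ?_ ?_ ?_
    · rintro A B hAB ⟨C, hC⟩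
      exact ⟨C, fun s hs => hC s (hAB hs)⟩
    · rintro A B ⟨C, hC⟩ ⟨D, hD⟩
      refine ⟨max C D, fun s hs => ?_⟩
      rcases hs with hs | hs
      · exact (hC s hs).trans (le_max_left _ _)
      · exact (hD s hs).trans (le_max_right _ _)
    · intro s _
      have h₁ : ∀ᶠ u in 𝓝[≥] s, |x u| < |x s| + 1 :=
        (hx s).1.abs.eventually_lt_const (lt_add_one _)
      have h₂ : ∀ᶠ u in 𝓝[<] s, |x u| < |Function.leftLim x s| + 1 :=
        (hx.tendsto_leftLim s).abs.eventually_lt_const (lt_add_one _)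
      have h₃ : ∀ᶠ u in 𝓝 s, |x u| ≤ max (|x s| + 1) (|Function.leftLim x s| + 1) := by
        rw [← nhdsLT_sup_nhdsGE, eventually_sup]
        exact ⟨h₂.mono fun u hu => hu.le.trans (le_max_right _ _),
          h₁.mono fun u hu => hu.le.trans (le_max_left _ _)⟩
      exact ⟨_, mem_nhdsWithin_of_mem_nhds h₃, _, fun u hu => hu⟩
  obtain ⟨C, hC⟩ := hp
  exact ⟨C, fun s hs => hC s ⟨zero_le, hs⟩⟩

lemma IsCadlag.abs_leftLim_le {x : ℝ≥0 → ℝ} (hx : IsCadlag x) {s t : ℝ≥0} {C : ℝ}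
    (hC : ∀ u ∈ Ico s t, |x u| ≤ C) {u : ℝ≥0} (hu : u ∈ Ioc s t) : |Function.leftLim x u| ≤ C := by
  have := nhdsLT_neBot_of_pos (zero_le.trans_lt hu.1)
  refine le_of_tendsto (hx.tendsto_leftLim u).abs ?_
  filter_upwards [Ioo_mem_nhdsLT hu.1] with v hv using hC v ⟨hv.1.le, hv.2.trans_le hu.2⟩

lemma IsCadlag.measurable_leftLim {x : ℝ≥0 → ℝ} (hx : IsCadlag x) :
    Measurable (Function.leftLim x) := by
  -- the left limit at `t` is the limit along the largest multiples of `1 / n` smaller than `t`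
  let φ (n : ℕ) (t : ℝ≥0) : ℝ≥0 := ((⌈(n + 1 : ℝ≥0) * t⌉₊ - 1 : ℕ) : ℝ≥0) / (n + 1)
  have hφ (n : ℕ) : Measurable fun t => x (φ n t) := by
    have h1 : Measurable fun t : ℝ≥0 => ⌈(n + 1 : ℝ≥0) * t⌉₊ :=
      Nat.measurable_ceil.comp (measurable_const.mul measurable_id)
    exact (measurable_from_nat (f := fun k : ℕ => x (((k - 1 : ℕ) : ℝ≥0) / (n + 1)))).comp h1
  refine measurable_of_tendsto_metrizable (f := fun n t => x (φ n t)) hφ ?_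
  rw [tendsto_pi_nhds]
  intro t
  rcases eq_zero_or_pos t with rfl | ht
  · rw [leftLim_eq_of_eq_bot _ (by simp)]
    simp [φ]
  · have hlt (n : ℕ) : φ n t < t := by
      have h0 : (0 : ℝ≥0) < n + 1 := by positivity
      have hc : 0 < ⌈(n + 1 : ℝ≥0) * t⌉₊ := Nat.ceil_pos.2 (mul_pos h0 ht)
      rw [div_lt_iff₀ h0, mul_comm t]
      exact Nat.lt_ceil.1 (Nat.sub_lt hc one_pos)
    refine (hx.tendsto_leftLim t).comp (tendsto_nhdsWithin_iff.2 ⟨?_, ?_⟩)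
    · rw [← NNReal.tendsto_coe]
      have hlim : Tendsto (fun n : ℕ => (t : ℝ) - 1 / ((n : ℝ) + 1)) atTop (𝓝 (t - 0)) :=
        tendsto_const_nhds.sub tendsto_one_div_add_atTop_nhds_zero_nat
      rw [sub_zero] at hlim
      refine tendsto_of_tendsto_of_tendsto_of_le_of_le hlim tendsto_const_nhds ?_ ?_
      · intro n
        have h0 : (0 : ℝ) < n + 1 := by positivity
        have hle : ((n + 1 : ℝ≥0) * t : ℝ≥0) ≤ (⌈(n + 1 : ℝ≥0) * t⌉₊ : ℝ≥0) := Nat.le_ceil _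
        have hle' : ((n : ℝ) + 1) * t ≤ (⌈(n + 1 : ℝ≥0) * t⌉₊ : ℝ) := by exact_mod_cast hle
        have hsub : (⌈(n + 1 : ℝ≥0) * t⌉₊ : ℝ) - 1 ≤ ((⌈(n + 1 : ℝ≥0) * t⌉₊ - 1 : ℕ) : ℝ) := by
          have : ⌈(n + 1 : ℝ≥0) * t⌉₊ ≤ (⌈(n + 1 : ℝ≥0) * t⌉₊ - 1) + 1 := by omega
          have : (⌈(n + 1 : ℝ≥0) * t⌉₊ : ℝ) ≤ ((⌈(n + 1 : ℝ≥0) * t⌉₊ - 1 : ℕ) : ℝ) + 1 := by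
            exact_mod_cast this
          linarith
        simp only [φ, NNReal.coe_div, NNReal.coe_natCast, NNReal.coe_add, NNReal.coe_one]
        rw [le_div_iff₀ h0, sub_mul, one_div, inv_mul_cancel₀ h0.ne']
        linarith
      · exact fun n => NNReal.coe_le_coe.2 (hlt n).le
    · exact Eventually.of_forall hlt

/-! ### Positivity of the solution of a linear integral equation with jumps -/

lemma setIntegral_Ioc_sub {ν : Measure ℝ≥0} {f : ℝ≥0 → ℝ} {s t : ℝ≥0} (hst : s ≤ t)
    (hf : IntegrableOn f (Ioc 0 t) ν) :
    ∫ u in Ioc 0 t, f u ∂ν - ∫ u in Ioc 0 s, f u ∂ν = ∫ u in Ioc s t, f u ∂ν := by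
  rw [← Ioc_union_Ioc_eq_Ioc (zero_le (a := s)) hst,
    setIntegral_union (Ioc_disjoint_Ioc_of_le le_rfl) measurableSet_Ioc
    (hf.mono_set (Ioc_subset_Ioc_right hst))
    (hf.mono_set (Ioc_subset_Ioc_left zero_le))]
  ring

/-- On an interval `[s, t)` where a path moves at a speed of at most `K` times its supremum, with
`K (t - s) ≤ 1 / 4`, the path stays comparable to its initial value. -/
lemma half_le_of_increment_bound {z : ℝ≥0 → ℝ} {s t : ℝ≥0} (hst : s < t) {K C : ℝ} (hK : 0 ≤ K)
    (hC : ∀ u ∈ Ico s t, |z u| ≤ C) (hKt : K * (t - s) ≤ 1 / 4) (hs : 0 < z s)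
    (hinc : ∀ m, (∀ u ∈ Ico s t, |z u| ≤ m) → ∀ u ∈ Ico s t, |z u - z s| ≤ K * m * (u - s)) :
    ∀ u ∈ Ico s t, z s / 2 ≤ z u := by
  set m : ℝ := sSup ((fun u => |z u|) '' Ico s t) with hm
  have hbdd : BddAbove ((fun u => |z u|) '' Ico s t) := ⟨C, by rintro _ ⟨u, hu, rfl⟩; exact hC u hu⟩
  have hne : ((fun u => |z u|) '' Ico s t).Nonempty := ⟨_, s, ⟨le_rfl, hst⟩, rfl⟩
  have hle : ∀ u ∈ Ico s t, |z u| ≤ m := fun u hu => le_csSup hbdd ⟨u, hu, rfl⟩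
  have hm0 : 0 ≤ m := (abs_nonneg _).trans (hle s ⟨le_rfl, hst⟩)
  have h4 : ∀ u ∈ Ico s t, |z u - z s| ≤ m / 4 := by
    intro u hu
    refine (hinc m hle u hu).trans ?_
    have : (u : ℝ) - s ≤ t - s := by
      have : (u : ℝ) ≤ t := NNReal.coe_le_coe.2 hu.2.le
      linarith
    calc K * m * (u - s) ≤ K * m * (t - s) := by gcongr
      _ = m * (K * (t - s)) := by ring
      _ ≤ m * (1 / 4) := by gcongr
      _ = m / 4 := by ring
  have hm2 : m ≤ z s + m / 4 := by
    refine csSup_le hne ?_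
    rintro _ ⟨u, hu, rfl⟩
    have := abs_le.1 (h4 u hu)
    rw [abs_le]
    constructor <;> linarith
  intro u hu
  have := abs_le.1 (h4 u hu)
  linarith

/-- A càdlàg solution of `dz = ∑ i, h i z₋ dν i - a z₋ dt` with `z 0 = 1` is positive if the
jumps `1 + ∑ i, h i t * ν i {t}` are positive and every `t` has a left neighbourhood without mass
of the measures `ν i`. -/
theorem pos_of_linear_equation {ι : Type*} [Fintype ι] {ν : ι → Measure ℝ≥0}
    {h : ι → ℝ≥0 → ℝ} {a z : ℝ≥0 → ℝ} (hz : IsCadlag z)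
    (hI : ∀ i t, IntegrableOn (fun s => h i s * Function.leftLim z s) (Ioc 0 t) (ν i))
    (hJ : ∀ t, IntegrableOn (fun s => a s * Function.leftLim z s) (Ioc 0 t) lebesgue)
    (ha : ∀ t, ∃ K, ∀ s ≤ t, |a s| ≤ K)
    (heq : ∀ t, z t = 1 + ∑ i, ∫ s in Ioc 0 t, h i s * Function.leftLim z s ∂ν i -
      ∫ s in Ioc 0 t, a s * Function.leftLim z s ∂lebesgue)
    (hν : ∀ t, 0 < t → ∃ s < t, ∀ i, ν i (Ioo s t) = 0)
    (hpos : ∀ t, 0 < t → 0 < 1 + ∑ i, h i t * (ν i).real {t}) (t : ℝ≥0) : 0 < z t := by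
  have hz0 : z 0 = 1 := by rw [heq]; simp
  have hincr {s t : ℝ≥0} (hst : s ≤ t) : z t - z s =
      ∑ i, ∫ u in Ioc s t, h i u * Function.leftLim z u ∂ν i -
      ∫ u in Ioc s t, a u * Function.leftLim z u ∂lebesgue := by
    rw [heq t, heq s, ← setIntegral_Ioc_sub hst (hJ t)]
    simp_rw [← fun i => setIntegral_Ioc_sub hst (hI i t), Finset.sum_sub_distrib]
    ring
  by_contra hneg
  -- look at the first time where `z` is not positive
  set S : Set ℝ≥0 := {u | z u ≤ 0} with hS
  have hSne : S.Nonempty := ⟨t, not_lt.1 hneg⟩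
  set τ := sInf S with hτ
  have hlt : ∀ u < τ, 0 < z u := fun u hu => not_le.1 fun hle => notMem_of_lt_csInf' hu hle
  have hzτ : z τ ≤ 0 := by
    by_contra hcon
    have h1 : ∀ᶠ u in 𝓝[≥] τ, 0 < z u := (hz τ).1.eventually_const_lt (not_le.1 hcon)
    obtain ⟨v, hv, hv'⟩ := (mem_nhdsGE_iff_exists_Ico_subset' (a := τ) (u' := τ + 1) (by simp)).1 h1
    obtain ⟨w, hw, hwv⟩ := exists_lt_of_csInf_lt hSne (hτ ▸ hv : sInf S < v)
    exact absurd (show 0 < z w from hv' ⟨csInf_le' hw, hwv⟩) (not_lt.2 hw)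
  have hτ0 : 0 < τ := by
    rcases eq_zero_or_pos τ with h0 | h0
    · rw [h0, hz0] at hzτ; linarith
    · exact h0
  have := nhdsLT_neBot_of_pos hτ0
  obtain ⟨r, hr, hrν⟩ := hν τ hτ0
  obtain ⟨K, hK⟩ := ha τ
  have hK0 : 0 ≤ K := (abs_nonneg _).trans (hK 0 zero_le)
  obtain ⟨C, hC⟩ := hz.exists_bound τ
  have hbound {u v : ℝ≥0} {m : ℝ} (huv : u ≤ v) (hv : v ≤ τ) (hm : ∀ w ∈ Ico u v, |z w| ≤ m) :
      |∫ w in Ioc u v, a w * Function.leftLim z w ∂lebesgue| ≤ K * m * (v - u) := by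
    rw [← lebesgue_real_Ioc huv, ← Real.norm_eq_abs]
    refine norm_setIntegral_le_of_norm_le_const (lebesgue_Ioc_ne_top u v).lt_top fun w hw => ?_
    rw [norm_mul]
    exact mul_le_mul (hK w (hw.2.trans hv)) (hz.abs_leftLim_le hm hw) (norm_nonneg _) hK0
  -- `z` stays away from zero on an interval ending at `τ`
  have hclose : ∀ᶠ s : ℝ≥0 in 𝓝[<] τ, K * ((τ : ℝ) - s) ≤ 1 / 4 ∧ s ∈ Ioo r τ := by
    have hc : Tendsto (fun s : ℝ≥0 => K * ((τ : ℝ) - s)) (𝓝[<] τ) (𝓝 (K * ((τ : ℝ) - τ))) :=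
      ((by fun_prop : Continuous fun s : ℝ≥0 => K * ((τ : ℝ) - s)).tendsto τ).mono_left
        nhdsWithin_le_nhds
    rw [sub_self, mul_zero] at hc
    exact ((hc.eventually_lt_const (by norm_num : (0 : ℝ) < 1 / 4)).mono fun s hs => hs.le).and
      (Ioo_mem_nhdsLT hr)
  obtain ⟨s, hsK, hs⟩ := hclose.exists
  have hlow : ∀ u ∈ Ico s τ, z s / 2 ≤ z u := by
    refine half_le_of_increment_bound hs.2 hK0 (fun u hu => hC u hu.2.le) hsK (hlt s hs.2) ?_
    intro m hm u hu
    have hnull : ∑ i, ∫ w in Ioc s u, h i w * Function.leftLim z w ∂ν i = 0 := by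
      refine Finset.sum_eq_zero fun i _ => ?_
      refine setIntegral_measure_zero _ (measure_mono_null ?_ (hrν i))
      exact fun w hw => ⟨hs.1.trans hw.1, hw.2.trans_lt hu.2⟩
    rw [hincr hu.1, hnull, zero_sub, abs_neg]
    exact hbound hu.1 hu.2.le fun w hw => hm w ⟨hw.1, hw.2.trans hu.2⟩
  have hleft : 0 < Function.leftLim z τ := by
    refine lt_of_lt_of_le (half_pos (hlt s hs.2)) (ge_of_tendsto (hz.tendsto_leftLim τ) ?_)
    filter_upwards [Ioo_mem_nhdsLT hs.2] with u hu using hlow u ⟨hu.1.le, hu.2⟩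
  -- the jump at `τ`
  have hjump : z τ = Function.leftLim z τ * (1 + ∑ i, h i τ * (ν i).real {τ}) := by
    have hA (u : ℝ≥0) (hu : u ∈ Ioo r τ) : z τ - z u =
        Function.leftLim z τ * (∑ i, h i τ * (ν i).real {τ}) -
          ∫ w in Ioc u τ, a w * Function.leftLim z w ∂lebesgue := by
      rw [hincr hu.2.le, Finset.mul_sum]
      congr 1
      refine Finset.sum_congr rfl fun i _ => ?_
      have hae : Ioc u τ =ᵐ[ν i] ({τ} : Set ℝ≥0) := by
        rw [← Ioo_union_right hu.2]
        have h0 : (Ioo u τ : Set ℝ≥0) =ᵐ[ν i] (∅ : Set ℝ≥0) :=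
          ae_eq_empty.2 (measure_mono_null (Ioo_subset_Ioo_left hu.1.le) (hrν i))
        simpa using h0.union (ae_eq_refl ({τ} : Set ℝ≥0))
      rw [setIntegral_congr_set hae, integral_singleton, smul_eq_mul]
      ring
    have hB : Tendsto (fun u => ∫ w in Ioc u τ, a w * Function.leftLim z w ∂lebesgue) (𝓝[<] τ)
        (𝓝 0) := by
      have hc : Tendsto (fun s : ℝ≥0 => K * C * ((τ : ℝ) - s)) (𝓝[<] τ)
          (𝓝 (K * C * ((τ : ℝ) - τ))) :=
        ((by fun_prop : Continuous fun s : ℝ≥0 => K * C * ((τ : ℝ) - s)).tendsto τ).mono_left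
          nhdsWithin_le_nhds
      rw [sub_self, mul_zero] at hc
      refine squeeze_zero_norm' ?_ hc
      filter_upwards [self_mem_nhdsWithin] with u hu
      exact hbound (le_of_lt hu) le_rfl fun w hw => hC w hw.2.le
    have hD : Tendsto (fun u => z τ - z u) (𝓝[<] τ)
        (𝓝 (Function.leftLim z τ * (∑ i, h i τ * (ν i).real {τ}) - 0)) := by
      refine (tendsto_const_nhds.sub hB).congr' ?_
      filter_upwards [Ioo_mem_nhdsLT hr] with u hu using (hA u hu).symm
    have := tendsto_nhds_unique hD (tendsto_const_nhds.sub (hz.tendsto_leftLim τ))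
    linarith
  have := mul_pos hleft (hpos τ hτ0)
  linarith

/-! ### Counting paths and the exponential along a path -/

lemma monotone_of_jump_nonneg {x : ℝ≥0 → ℝ} (hx : IsCadlag x)
    (hr : ∀ t, ∀ᶠ s in 𝓝[≥] t, x s = x t) (hj : ∀ t, 0 ≤ jump x t) : Monotone x := by
  intro s t hst
  by_contra hneg
  -- look at the first time after `s` where the path is below `x s`
  set S : Set ℝ≥0 := {u | s ≤ u ∧ x u < x s} with hS
  have hSne : S.Nonempty := ⟨t, hst, not_le.1 hneg⟩
  set τ := sInf S with hτ
  have hsτ : s ≤ τ := le_csInf hSne fun u hu => hu.1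
  have hlt : ∀ u, s ≤ u → u < τ → x s ≤ x u := fun u hsu hu =>
    not_lt.1 fun h => notMem_of_lt_csInf' hu ⟨hsu, h⟩
  have hxτ : x s ≤ x τ := by
    rcases hsτ.eq_or_lt with h | h
    · rw [← h]
    · have := nhdsLT_neBot_of_pos (zero_le.trans_lt h)
      have hl : x s ≤ Function.leftLim x τ := by
        refine ge_of_tendsto (hx.tendsto_leftLim τ) ?_
        filter_upwards [Ioo_mem_nhdsLT h] with u hu using hlt u hu.1.le hu.2
      have := hj τ
      rw [jump] at this
      linarith
  obtain ⟨v, hv, hv'⟩ :=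
    (mem_nhdsGE_iff_exists_Ico_subset' (a := τ) (u' := τ + 1) (by simp)).1 (hr τ)
  obtain ⟨w, hw, hwv⟩ := exists_lt_of_csInf_lt hSne (hτ ▸ hv : sInf S < v)
  have h1 : x w = x τ := hv' ⟨csInf_le' hw, hwv⟩
  have h2 := hw.2
  linarith

/-- The measure which counts the jumps of a counting path. -/
lemma exists_jump_measure {x : ℝ≥0 → ℝ} (hx : IsCadlag x)
    (hr : ∀ t, ∀ᶠ s in 𝓝[≥] t, x s = x t) (hl : ∀ t, ∃ c, ∀ᶠ s in 𝓝[<] t, x s = c)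
    (hj : ∀ t, jump x t = 0 ∨ jump x t = 1) :
    ∃ ν : Measure ℝ≥0, (∀ a b, ν (Ioc a b) = ENNReal.ofReal (x b - x a)) ∧
      (∀ t, ν.real {t} = jump x t) ∧ (∀ t, 0 < t → ∃ s < t, ν (Ioo s t) = 0) ∧ Monotone x := by
  have hj0 (t) : 0 ≤ jump x t := by rcases hj t with h | h <;> rw [h]; exact zero_le_one
  have hmono := monotone_of_jump_nonneg hx hr hj0
  let F : StieltjesFunction ℝ≥0 := ⟨x, hmono, fun t => (hx t).1⟩
  refine ⟨F.measure, F.measure_Ioc, fun t => ?_, fun t ht => ?_, hmono⟩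
  · rw [Measure.real, F.measure_singleton]
    exact ENNReal.toReal_ofReal (hj0 t)
  · have := nhdsLT_neBot_of_pos ht
    obtain ⟨c, hc⟩ := hl t
    obtain ⟨r, hr, hrc⟩ := (mem_nhdsLT_iff_exists_Ioo_subset' ht).1 hc
    obtain ⟨s, hs⟩ := exists_between (show r < t from hr)
    refine ⟨s, hs.2, ?_⟩
    have h1 : Function.leftLim x t = c := tendsto_nhds_unique (hx.tendsto_leftLim t)
      (tendsto_const_nhds.congr' (hc.mono fun u hu => hu.symm))
    have h2 : x s = c := hrc hs
    rw [F.measure_Ioo, show (F : ℝ≥0 → ℝ) = x from rfl, h1, h2, sub_self, ENNReal.ofReal_zero]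

lemma integrableOn_of_bound {ν : Measure ℝ≥0} {t : ℝ≥0} (hν : ν (Ioc 0 t) ≠ ∞) {f : ℝ≥0 → ℝ}
    (hf : Measurable f) {C : ℝ} (hC : ∀ s ≤ t, |f s| ≤ C) : IntegrableOn f (Ioc 0 t) ν :=
  Measure.integrableOn_of_bounded hν hf.aestronglyMeasurable
    (ae_restrict_of_forall_mem measurableSet_Ioc fun s hs => hC s hs.2)

/-- Along a path, the exponential of `∑ i, ∫ (g i - 1) d(n i - ∫ l i)` is positive if the
factors `g i` are positive at the jumps of `n i`. -/
theorem exponential_pos_of_path {d : ℕ} {n l g : Fin d → ℝ≥0 → ℝ} {z : ℝ≥0 → ℝ}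
    {ν : Fin d → Measure ℝ≥0} (hn : ∀ i, Monotone (n i))
    (hν : ∀ i a b, ν i (Ioc a b) = ENNReal.ofReal (n i b - n i a))
    (hνj : ∀ i t, (ν i).real {t} = jump (n i) t)
    (hνl : ∀ i t, 0 < t → ∃ s < t, ν i (Ioo s t) = 0)
    (hl : ∀ i, Measurable (l i)) (hlb : ∀ i t, ∃ C, ∀ s ≤ t, |l i s| ≤ C)
    (hg : ∀ i, Measurable (g i)) (hgb : ∀ i t, ∃ C, ∀ s ≤ t, |g i s| ≤ C)
    (hj : ∀ i t, jump (n i) t = 0 ∨ jump (n i) t = 1)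
    (hcommon : ∀ i j, i ≠ j → ∀ t, jump (n i) t = 0 ∨ jump (n j) t = 0)
    (hgpos : ∀ i t, jump (n i) t = 1 → 0 < g i t) (hz : IsCadlag z)
    (heq : ∀ t, z t = 1 + stieltjesIntegral (Function.leftLim z) (fun s => ∑ i,
      stieltjesIntegral (fun u => g i u - 1)
        (fun u => n i u - ∫ r in Ioc 0 u, l i r ∂lebesgue) s) t) (t : ℝ≥0) :
    0 < z t := by
  have hνt (i t) : ν i (Ioc 0 t) ≠ ∞ := by rw [hν]; exact ENNReal.ofReal_ne_top
  have hνr (i t) : n i t = n i 0 + (ν i).real (Ioc 0 t) := by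
    rw [Measure.real, hν, ENNReal.toReal_ofReal (sub_nonneg.2 (hn i zero_le))]; ring
  set h : Fin d → ℝ≥0 → ℝ := fun i u => g i u - 1 with hh
  have hhm (i) : Measurable (h i) := (hg i).sub_const 1
  have hhb (i t) : ∃ C, ∀ s ≤ t, |h i s| ≤ C := by
    obtain ⟨C, hC⟩ := hgb i t
    refine ⟨C + 1, fun s hs => (abs_sub _ _).trans ?_⟩
    rw [abs_one]
    linarith [hC s hs]
  have hlI (i t) : IntegrableOn (l i) (Ioc 0 t) lebesgue :=
    integrableOn_of_bound (lebesgue_Ioc_ne_top 0 t) (hl i) (hlb i t).choose_spec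
  -- `d(n i - ∫ l i)` has density `1` with respect to `ν i` and `- l i` with respect to `lebesgue`
  let κ (p : Fin d × Bool) : Measure ℝ≥0 := if p.2 then ν p.1 else lebesgue
  let G (p : Fin d × Bool) (u : ℝ≥0) : ℝ := if p.2 then 1 else - l p.1 u
  have hGI (p t) : IntegrableOn (G p) (Ioc 0 t) (κ p) := by
    rcases p with ⟨i, b | b⟩
    · simpa [G, κ] using (hlI i t).neg
    · simpa [G, κ, IntegrableOn, integrable_const_iff, isFiniteMeasure_iff] using (hνt i t).lt_top
  have hX (s : ℝ≥0) : ∑ i, stieltjesIntegral (h i)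
      (fun u => n i u - ∫ r in Ioc 0 u, l i r ∂lebesgue) s =
      0 + ∑ p, ∫ u in Ioc 0 s, G p u * h p.1 u ∂κ p := by
    rw [zero_add, Fintype.sum_prod_type]
    refine Finset.sum_congr rfl fun i _ => ?_
    obtain ⟨C, hC⟩ := hhb i s
    refine stieltjesIntegral_eq_sum (c := n i 0) (fun b => hGI (i, b) s) (fun u _ => ?_) (hhm i)
      (fun u hu => hC u hu.2)
    simp [G, κ, integral_neg, hνr i u]
    ring
  have hzm := hz.measurable_leftLim
  obtain hzb : ∀ t, ∃ C, ∀ s ≤ t, |Function.leftLim z s| ≤ C := by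
    intro t
    obtain ⟨C, hC⟩ := hz.exists_bound t
    refine ⟨max C |z 0|, fun s hs => ?_⟩
    rcases eq_zero_or_pos s with rfl | h0
    · rw [leftLim_eq_of_eq_bot _ (by simp)]
      exact le_max_right _ _
    · exact (hz.abs_leftLim_le (s := 0) (t := t) (fun u hu => hC u hu.2.le) ⟨h0, hs⟩).trans
        (le_max_left _ _)
  have hGhI (p : Fin d × Bool) (t) : IntegrableOn (fun u => G p u * h p.1 u) (Ioc 0 t) (κ p) := by
    obtain ⟨C, hC⟩ := hhb p.1 t
    exact (hGI p t).mul_bdd (hhm p.1).aestronglyMeasurable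
      (ae_restrict_of_forall_mem measurableSet_Ioc fun s hs => hC s hs.2)
  have hGzI (p : Fin d × Bool) (t) :
      IntegrableOn (fun u => G p u * h p.1 u * Function.leftLim z u) (Ioc 0 t) (κ p) := by
    obtain ⟨C, hC⟩ := hzb t
    exact (hGhI p t).mul_bdd hzm.aestronglyMeasurable
      (ae_restrict_of_forall_mem measurableSet_Ioc fun s hs => hC s hs.2)
  have hν1 (i t) : IntegrableOn (fun u => h i u * Function.leftLim z u) (Ioc 0 t) (ν i) := by
    simpa [G, κ] using hGzI (i, true) t
  have hl1 (i t) : IntegrableOn (fun u => l i u * h i u * Function.leftLim z u) (Ioc 0 t)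
      lebesgue := by
    simpa [G, κ] using (hGzI (i, false) t).neg
  refine pos_of_linear_equation (ν := ν) (h := h) (a := fun u => ∑ i, l i u * h i u) hz hν1 ?_ ?_
    ?_ ?_ ?_ t
  · intro t
    simp_rw [Finset.sum_mul]
    exact integrable_finsetSum _ fun i _ => hl1 i t
  · intro t
    choose C hC using fun i => hlb i t
    choose D hD using fun i => hhb i t
    refine ⟨∑ i, C i * D i, fun s hs => (Finset.abs_sum_le_sum_abs _ _).trans ?_⟩
    refine Finset.sum_le_sum fun i _ => ?_
    rw [abs_mul]
    exact mul_le_mul (hC i s hs) (hD i s hs) (abs_nonneg _) ((abs_nonneg _).trans (hC i s hs))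
  · intro t
    obtain ⟨C, hC⟩ := hzb t
    rw [heq t, stieltjesIntegral_eq_sum (c := 0) (fun p => hGhI p t) (fun s _ => hX s) hzm
      (fun s hs => hC s hs.2), Fintype.sum_prod_type]
    simp_rw [Finset.sum_mul]
    rw [integral_finsetSum _ fun i _ => hl1 i t, add_sub_assoc, ← Finset.sum_sub_distrib]
    congr 1
    refine Finset.sum_congr rfl fun i _ => ?_
    simp [G, κ, integral_neg]
    ring
  · intro t ht
    choose s hs hs' using fun i => hνl i t ht
    rcases isEmpty_or_nonempty (Fin d) with hd | hd
    · exact ⟨0, ht, fun i => (hd.false i).elim⟩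
    · refine ⟨Finset.univ.sup' Finset.univ_nonempty s, ?_, fun i => ?_⟩
      · exact (Finset.sup'_lt_iff _).2 fun i _ => hs i
      · exact measure_mono_null
          (Ioo_subset_Ioo_left (Finset.le_sup' s (Finset.mem_univ i))) (hs' i)
  · intro t ht
    simp_rw [hνj]
    by_cases hall : ∀ i, jump (n i) t = 0
    · simp [hall]
    · push Not at hall
      obtain ⟨i, hi⟩ := hall
      rw [Finset.sum_eq_single i (fun j _ hji => by
        rcases hcommon j i hji t with h0 | h0
        · rw [h0, mul_zero]
        · exact absurd h0 hi) (fun h0 => absurd (Finset.mem_univ i) h0)]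
      have h1 := (hj i t).resolve_left hi
      have := hgpos i t h1
      rw [h1, hh]
      linarith

/-! ### Optional stopping for càdlàg martingales -/

variable {Ω : Type*} {mΩ : MeasurableSpace Ω} {P : Measure Ω}

lemma tendsto_integral_of_uniformIntegrable [IsFiniteMeasure P] {f : ℕ → Ω → ℝ} {g : Ω → ℝ}
    (hf : UniformIntegrable f 1 P) (hfg : ∀ᵐ ω ∂P, Tendsto (fun n => f n ω) atTop (𝓝 (g ω))) :
    Integrable g P ∧ Tendsto (fun n => ∫ ω, f n ω ∂P) atTop (𝓝 (∫ ω, g ω ∂P)) := by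
  have hg : MemLp g 1 P := hf.memLp_of_ae_tendsto hfg
  refine ⟨memLp_one_iff_integrable.1 hg, ?_⟩
  refine tendsto_integral_of_L1' g hg.1
    (Eventually.of_forall fun n => memLp_one_iff_integrable.1 (hf.memLp n)) ?_
  exact tendsto_Lp_finite_of_tendsto_ae le_rfl ENNReal.one_ne_top hf.aestronglyMeasurable hg
    hf.unifIntegrable hfg

/-- The approximation of a time from above by multiples of `1 / (m + 1)`, capped at `k`. -/
noncomputable def upperApprox (k : ℝ≥0) (m : ℕ) (s : ℝ≥0) : ℝ≥0 :=
  min (((⌊(m + 1 : ℝ≥0) * s⌋₊ + 1 : ℕ) : ℝ≥0) / (m + 1)) k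

lemma le_upperApprox {k s : ℝ≥0} (hs : s ≤ k) (m : ℕ) : s ≤ upperApprox k m s := by
  refine le_min ?_ hs
  have h0 : (0 : ℝ≥0) < m + 1 := by positivity
  rw [le_div_iff₀ h0, mul_comm]
  exact_mod_cast (Nat.lt_floor_add_one ((m + 1 : ℝ≥0) * s)).le

lemma tendsto_upperApprox {k s : ℝ≥0} (hs : s ≤ k) :
    Tendsto (fun m => upperApprox k m s) atTop (𝓝[≥] s) := by
  refine tendsto_nhdsWithin_iff.2 ⟨?_, Eventually.of_forall fun m => le_upperApprox hs m⟩
  rw [← NNReal.tendsto_coe]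
  have hlim : Tendsto (fun n : ℕ => (s : ℝ) + 1 / ((n : ℝ) + 1)) atTop (𝓝 (s + 0)) :=
    tendsto_const_nhds.add tendsto_one_div_add_atTop_nhds_zero_nat
  rw [add_zero] at hlim
  refine tendsto_of_tendsto_of_tendsto_of_le_of_le tendsto_const_nhds hlim
    (fun m => NNReal.coe_le_coe.2 (le_upperApprox hs m)) fun m => ?_
  have h0 : (0 : ℝ) < m + 1 := by positivity
  have h1 : (⌊(m + 1 : ℝ≥0) * s⌋₊ : ℝ≥0) ≤ (m + 1 : ℝ≥0) * s := Nat.floor_le zero_le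
  have h2 : (⌊(m + 1 : ℝ≥0) * s⌋₊ : ℝ) ≤ (m + 1) * s := by exact_mod_cast h1
  have h3 : upperApprox k m s ≤ ((⌊(m + 1 : ℝ≥0) * s⌋₊ + 1 : ℕ) : ℝ≥0) / (m + 1) :=
    min_le_left _ _
  refine (NNReal.coe_le_coe.2 h3).trans ?_
  simp only [NNReal.coe_div, NNReal.coe_natCast, NNReal.coe_add, NNReal.coe_one, Nat.cast_add,
    Nat.cast_one]
  rw [div_le_iff₀ h0, add_mul (s : ℝ), one_div, inv_mul_cancel₀ h0.ne']
  linarith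

lemma isStoppingTime_upperApprox {𝓕 : Filtration ℝ≥0 mΩ} {σ : Ω → ℝ≥0}
    (hσ : IsStoppingTime 𝓕 fun ω => (σ ω : WithTop ℝ≥0)) (k : ℝ≥0) (m : ℕ) :
    IsStoppingTime 𝓕 fun ω => (upperApprox k m (σ ω) : WithTop ℝ≥0) := by
  intro u
  have h0 : (0 : ℝ≥0) < m + 1 := by positivity
  rcases le_or_gt k u with hku | hku
  · convert MeasurableSet.univ
    ext ω
    exact iff_of_true (WithTop.coe_le_coe.2
      ((min_le_right _ _ : upperApprox k m (σ ω) ≤ k).trans hku)) trivial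
  · set v : ℝ≥0 := (⌊(m + 1 : ℝ≥0) * u⌋₊ : ℝ≥0) / (m + 1) with hv
    have hvu : v ≤ u := by
      rw [hv, div_le_iff₀ h0, mul_comm]
      exact Nat.floor_le zero_le
    have hlt := 𝓕.mono hvu _ (hσ.measurableSet_lt v)
    convert hlt using 1
    ext ω
    simp only [mem_ofPred_eq, WithTop.coe_le_coe, WithTop.coe_lt_coe, upperApprox, min_le_iff,
      not_le.2 hku, or_false]
    rw [div_le_iff₀ h0, mul_comm u, hv, lt_div_iff₀ h0, mul_comm (σ ω), ← Nat.le_floor_iff zero_le,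
      Nat.succ_le_iff, Nat.floor_lt zero_le]

/-- **Optional stopping** for a càdlàg martingale and a bounded stopping time. -/
theorem integral_stopped_of_cadlag_martingale [IsFiniteMeasure P] {𝓕 : Filtration ℝ≥0 mΩ}
    {Y : ℝ≥0 → Ω → ℝ} (hY : Martingale Y 𝓕 P) (hc : ∀ᵐ ω ∂P, IsCadlag fun t => Y t ω)
    {σ : Ω → ℝ≥0} (hσ : IsStoppingTime 𝓕 fun ω => (σ ω : WithTop ℝ≥0)) {k : ℝ≥0}
    (hk : ∀ ω, σ ω ≤ k) :
    Integrable (fun ω => Y (σ ω) ω) P ∧ ∫ ω, Y (σ ω) ω ∂P = ∫ ω, Y k ω ∂P := by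
  have hst := isStoppingTime_upperApprox hσ k
  have hle (m : ℕ) (ω : Ω) : (upperApprox k m (σ ω) : WithTop ℝ≥0) ≤ k :=
    WithTop.coe_le_coe.2 (min_le_right _ _)
  have hcount (m : ℕ) : (range fun ω => (upperApprox k m (σ ω) : WithTop ℝ≥0)).Countable := by
    refine (countable_range fun j : ℕ =>
      ((min (((j + 1 : ℕ) : ℝ≥0) / (m + 1)) k : ℝ≥0) : WithTop ℝ≥0)).mono ?_
    rintro _ ⟨ω, rfl⟩
    exact ⟨_, rfl⟩
  have hm (m : ℕ) := (hst m).measurableSpace_le_of_le (hle m)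
  have heq (m : ℕ) : (fun ω => Y (upperApprox k m (σ ω)) ω) =ᵐ[P]
      P[Y k | (hst m).measurableSpace] :=
    hY.stoppedValue_ae_eq_condExp_of_le_const_of_countable_range (hst m) (hle m) (hcount m)
  have hUI : UniformIntegrable (fun m ω => Y (upperApprox k m (σ ω)) ω) 1 P :=
    ((hY.integrable k).uniformIntegrable_condExp hm).ae_eq fun m => (heq m).symm
  have hlim : ∀ᵐ ω ∂P, Tendsto (fun m => Y (upperApprox k m (σ ω)) ω) atTop (𝓝 (Y (σ ω) ω)) := by
    filter_upwards [hc] with ω hω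
    exact ((hω (σ ω)).1.tendsto).comp (tendsto_upperApprox (hk ω))
  obtain ⟨h1, h2⟩ := tendsto_integral_of_uniformIntegrable hUI hlim
  refine ⟨h1, tendsto_nhds_unique h2 (tendsto_const_nhds.congr fun m => ?_)⟩
  rw [integral_congr_ae (heq m), integral_condExp (hm m)]

/-! ### The compensator of a counting process on predictable sets -/

lemma predictable_le_prod (𝓕 : Filtration ℝ≥0 mΩ) :
    𝓕.predictable ≤ (inferInstance : MeasurableSpace (ℝ≥0 × Ω)) :=
  measurableSpace_le_predictable_of_measurableSet
    (fun _ hA => (measurableSet_singleton _).prod (𝓕.le _ _ hA))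
    (fun _ _ hA => measurableSet_Ioi.prod (𝓕.le _ _ hA))

lemma isPiSystem_predictable (𝓕 : Filtration ℝ≥0 mΩ) :
    IsPiSystem ({s | ∃ A, MeasurableSet[𝓕 ⊥] A ∧ s = {⊥} ×ˢ A} ∪
      {s | ∃ i A, MeasurableSet[𝓕 i] A ∧ s = Ioi i ×ˢ A}) := by
  have hbot (i : ℝ≥0) : ({⊥} ∩ Ioi i : Set ℝ≥0) = ∅ := by
    ext x
    simp only [mem_inter_iff, mem_singleton_iff, mem_Ioi, mem_empty_iff_false, iff_false, not_and,
      not_lt]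
    rintro rfl
    exact bot_le
  rintro _ (⟨A, hA, rfl⟩ | ⟨i, A, hA, rfl⟩) _ (⟨B, hB, rfl⟩ | ⟨j, B, hB, rfl⟩) hne
  · exact Or.inl ⟨A ∩ B, hA.inter hB, by rw [prod_inter_prod, inter_self]⟩
  · rw [prod_inter_prod, hbot, empty_prod] at hne
    simp at hne
  · rw [prod_inter_prod, inter_comm, hbot, empty_prod] at hne
    simp at hne
  · exact Or.inr ⟨max i j, A ∩ B, (𝓕.mono (le_max_left _ _) _ hA).inter
      (𝓕.mono (le_max_right _ _) _ hB), by rw [prod_inter_prod, Ioi_inter_Ioi]⟩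

/-- The measure with density `l` with respect to Lebesgue measure on the time axis. -/
noncomputable def densityMeasure (l : ℝ≥0 → ℝ) : Measure ℝ≥0 :=
  lebesgue.withDensity fun s => ENNReal.ofReal (l s)

lemma measurable_densityMeasure_section {l : ℝ≥0 → Ω → ℝ}
    (hl : Measurable (Function.uncurry l)) {B : Set (ℝ≥0 × Ω)} (hB : MeasurableSet B) :
    Measurable fun ω => densityMeasure (fun s => l s ω) {s | (s, ω) ∈ B} := by
  have h (ω : Ω) : densityMeasure (fun s => l s ω) {s | (s, ω) ∈ B} =
      ∫⁻ s, B.indicator (fun p => ENNReal.ofReal (l p.1 p.2)) (s, ω) ∂lebesgue := by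
    have hm : MeasurableSet {s : ℝ≥0 | (s, ω) ∈ B} := measurable_prodMk_right hB
    rw [densityMeasure, withDensity_apply _ hm, ← lintegral_indicator hm]
    rfl
  simp_rw [h]
  exact (hl.ennreal_ofReal.indicator hB).lintegral_prod_left'

/-- The increment of a càdlàg martingale from `u` to a bounded stopping time `σ` has mean zero on
every event known at time `u` on which `σ` is later than `u`. -/
lemma setIntegral_increment_eq_zero [IsProbabilityMeasure P] {𝓕 : Filtration ℝ≥0 mΩ}
    {Y : ℝ≥0 → Ω → ℝ} (hY : Martingale Y 𝓕 P) (hc : ∀ᵐ ω ∂P, IsCadlag fun t => Y t ω)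
    {σ : Ω → ℝ≥0} (hσ : IsStoppingTime 𝓕 fun ω => (σ ω : WithTop ℝ≥0)) {k : ℝ≥0}
    (hk : ∀ ω, σ ω ≤ k) {u : ℝ≥0} {D : Set Ω} (hDu : MeasurableSet[𝓕 u] D)
    (hD : ∀ ω ∈ D, u < σ ω) : ∫ ω in D, (Y (σ ω) ω - Y u ω) ∂P = 0 := by
  rcases le_or_gt k u with hku | hku
  · have : D = ∅ := eq_empty_of_forall_notMem fun ω hω =>
      ((hk ω).trans hku).not_gt (hD ω hω)
    simp [this]
  obtain ⟨hYσ, -⟩ := integral_stopped_of_cadlag_martingale hY hc hσ hk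
  have hDm : MeasurableSet D := 𝓕.le u _ hDu
  classical
  -- stop at `σ` on `D`, and at the final time `k` elsewhere
  set ρ : Ω → ℝ≥0 := fun ω => if ω ∈ D then σ ω else k with hρ
  have hρst : IsStoppingTime 𝓕 fun ω => (ρ ω : WithTop ℝ≥0) := by
    intro v
    rcases le_or_gt k v with hkv | hkv
    · convert MeasurableSet.univ
      ext ω
      refine iff_of_true (WithTop.coe_le_coe.2 ?_) trivial
      simp only [hρ]
      split_ifs
      · exact (hk ω).trans hkv
      · exact hkv
    · have hset : {ω | (ρ ω : WithTop ℝ≥0) ≤ v} = D ∩ {ω | (σ ω : WithTop ℝ≥0) ≤ v} := by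
        ext ω
        simp only [mem_ofPred_eq, mem_inter_iff, WithTop.coe_le_coe, hρ]
        split_ifs with hω
        · simp [hω]
        · simp [hω, hkv]
      rw [hset]
      rcases le_or_gt u v with huv | huv
      · exact (𝓕.mono huv _ hDu).inter (hσ v)
      · convert MeasurableSet.empty
        ext ω
        simp only [mem_inter_iff, mem_ofPred_eq, WithTop.coe_le_coe, mem_empty_iff_false,
          iff_false, not_and, not_le]
        exact fun hω => huv.trans (hD ω hω)
  have hρk (ω) : ρ ω ≤ k := by
    simp only [hρ]; split_ifs
    · exact hk ω
    · exact le_rfl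
  obtain ⟨hYρ, hYρk⟩ := integral_stopped_of_cadlag_martingale hY hc hρst hρk
  have e1 := integral_add_compl hDm hYρ
  have e2 := integral_add_compl hDm (hY.integrable k)
  have e3 : ∫ ω in D, Y (ρ ω) ω ∂P = ∫ ω in D, Y (σ ω) ω ∂P :=
    setIntegral_congr_fun hDm fun ω hω => by simp [hρ, hω]
  have e4 : ∫ ω in Dᶜ, Y (ρ ω) ω ∂P = ∫ ω in Dᶜ, Y k ω ∂P :=
    setIntegral_congr_fun hDm.compl fun ω hω => by
      have : ω ∉ D := hω
      simp [hρ, this]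
  have e5 := hY.setIntegral_eq hku.le hDu
  rw [integral_sub hYσ.integrableOn (hY.integrable u).integrableOn]
  linarith

lemma densityMeasure_Ioc_le {l : ℝ≥0 → ℝ} {t : ℝ≥0} {C : ℝ} (hC : ∀ s ∈ Ioc 0 t, l s ≤ C) :
    densityMeasure l (Ioc 0 t) ≤ ENNReal.ofReal C * t := by
  rw [densityMeasure, withDensity_apply _ measurableSet_Ioc]
  calc ∫⁻ s in Ioc 0 t, ENNReal.ofReal (l s) ∂lebesgue
      ≤ ∫⁻ _ in Ioc 0 t, ENNReal.ofReal C ∂lebesgue :=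
        setLIntegral_mono measurable_const fun s hs => ENNReal.ofReal_le_ofReal (hC s hs)
    _ = ENNReal.ofReal C * lebesgue (Ioc 0 t) := setLIntegral_const _ _
    _ = ENNReal.ofReal C * t := by simp [lebesgue_Ioc]

lemma densityMeasure_Ioc_toReal {l : ℝ≥0 → ℝ} (hl : Measurable l) (hl0 : ∀ s, 0 ≤ l s)
    (u t : ℝ≥0) : (densityMeasure l (Ioc u t)).toReal = ∫ s in Ioc u t, l s ∂lebesgue := by
  rw [densityMeasure, withDensity_apply _ measurableSet_Ioc, integral_eq_lintegral_of_nonneg_ae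
    (ae_of_all _ hl0) hl.aestronglyMeasurable]

lemma measurable_of_isStoppingTime {𝓕 : Filtration ℝ≥0 mΩ} {σ : Ω → ℝ≥0}
    (hσ : IsStoppingTime 𝓕 fun ω => (σ ω : WithTop ℝ≥0)) : Measurable σ := by
  refine measurable_of_Iic fun u => ?_
  have := 𝓕.le u _ (hσ u)
  simp only [WithTop.coe_le_coe] at this
  exact this

lemma measurable_densityMeasure_strip {l : ℝ≥0 → Ω → ℝ} (hl : Measurable (Function.uncurry l))
    {σ : Ω → ℝ≥0} (hσ : Measurable σ) {A : Set (ℝ≥0 × Ω)} (hA : MeasurableSet A) :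
    Measurable fun ω =>
      densityMeasure (fun s => l s ω) ({s | (s, ω) ∈ A} ∩ Ioc 0 (σ ω)) := by
  have hstrip : MeasurableSet {p : ℝ≥0 × Ω | 0 < p.1 ∧ p.1 ≤ σ p.2} :=
    (measurableSet_lt measurable_const measurable_fst).inter
      (measurableSet_le (f := fun p : ℝ≥0 × Ω => p.1) (g := fun p => σ p.2) measurable_fst
        (hσ.comp measurable_snd))
  have h := measurable_densityMeasure_section hl (hA.inter hstrip)
  have hs (ω : Ω) : {s | (s, ω) ∈ A ∩ {p : ℝ≥0 × Ω | 0 < p.1 ∧ p.1 ≤ σ p.2}} =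
      {s | (s, ω) ∈ A} ∩ Ioc 0 (σ ω) := by
    ext s
    simp only [mem_inter_iff, mem_ofPred_eq, mem_Ioc]
  simpa only [hs] using h

lemma rectangle_section (u t : ℝ≥0) (F : Set Ω) (ω : Ω) :
    {s | (s, ω) ∈ Ioi u ×ˢ F} ∩ Ioc 0 t = {s | ω ∈ F ∧ s ∈ Ioc u t} := by
  ext s
  simp only [mem_inter_iff, mem_ofPred_eq, mem_prod, mem_Ioi, mem_Ioc]
  exact ⟨fun h => ⟨h.1.2, h.1.1, h.2.2⟩, fun h => ⟨⟨h.2.1, h.1⟩, zero_le.trans_lt h.2.1, h.2.2⟩⟩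

/-- The identity of `lintegral_jumps_predictable` for a predictable rectangle: this is optional
stopping. -/
lemma lintegral_jumps_rectangle [IsProbabilityMeasure P] {𝓕 : Filtration ℝ≥0 mΩ}
    {n l Y : ℝ≥0 → Ω → ℝ} {ν : Ω → Measure ℝ≥0} (hn : ∀ ω, Monotone fun t => n t ω)
    (hν : ∀ ω a b, ν ω (Ioc a b) = ENNReal.ofReal (n b ω - n a ω))
    (hl0 : ∀ t ω, 0 ≤ l t ω) (hl : Measurable (Function.uncurry l))
    (hY : Martingale Y 𝓕 P) (hc : ∀ᵐ ω ∂P, IsCadlag fun t => Y t ω)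
    {σ : Ω → ℝ≥0} (hσ : IsStoppingTime 𝓕 fun ω => (σ ω : WithTop ℝ≥0)) {k : ℝ≥0}
    (hk : ∀ ω, σ ω ≤ k) {C : ℝ} (hC : ∀ ω, ∀ s ∈ Ioc 0 (σ ω), l s ω ≤ C)
    (hYn : ∀ ω, 0 < σ ω → ∀ s ≤ σ ω, Y s ω = n s ω - ∫ u in Ioc 0 s, l u ω ∂lebesgue)
    (u : ℝ≥0) {F : Set Ω} (hF : MeasurableSet[𝓕 u] F) :
    AEMeasurable (fun ω => ν ω ({s | (s, ω) ∈ Ioi u ×ˢ F} ∩ Ioc 0 (σ ω))) P ∧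
      ∫⁻ ω, ν ω ({s | (s, ω) ∈ Ioi u ×ˢ F} ∩ Ioc 0 (σ ω)) ∂P =
        ∫⁻ ω, densityMeasure (fun s => l s ω)
          ({s | (s, ω) ∈ Ioi u ×ˢ F} ∩ Ioc 0 (σ ω)) ∂P := by
  set η : Ω → Measure ℝ≥0 := fun ω => densityMeasure fun s => l s ω with hη
  have hlω (ω) : Measurable fun s => l s ω := hl.comp measurable_prodMk_right
  have hσm := measurable_of_isStoppingTime hσ
  have hηbd (ω) : η ω (Ioc 0 (σ ω)) ≤ ENNReal.ofReal C * k :=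
    (densityMeasure_Ioc_le (hC ω)).trans (by gcongr; exact hk ω)
  have hηfin (ω) : η ω (Ioc 0 (σ ω)) ≠ ∞ :=
    ((hηbd ω).trans_lt (ENNReal.mul_lt_top ENNReal.ofReal_lt_top ENNReal.coe_lt_top)).ne
  have hηr (ω) : (η ω (Ioc u (σ ω))).toReal = ∫ s in Ioc u (σ ω), l s ω ∂lebesgue :=
    densityMeasure_Ioc_toReal (hlω ω) (fun s => hl0 s ω) _ _
  set D : Set Ω := F ∩ {ω | u < σ ω} with hD
  have hDu : MeasurableSet[𝓕 u] D := by
    refine hF.inter ?_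
    have := (hσ u).compl
    convert this using 1
    ext ω
    rw [mem_compl_iff, mem_ofPred_eq, mem_ofPred_eq, WithTop.coe_le_coe, not_le]
  have hDm : MeasurableSet D := 𝓕.le u _ hDu
  have hsec (m : Measure ℝ≥0) (ω) : m ({s | (s, ω) ∈ Ioi u ×ˢ F} ∩ Ioc 0 (σ ω)) =
      D.indicator (fun ω => m (Ioc u (σ ω))) ω := by
    rw [rectangle_section]
    by_cases hω : ω ∈ D
    · rw [indicator_of_mem hω]
      simp only [hω.1, true_and]
      rfl
    · rw [indicator_of_notMem hω]
      by_cases hF' : ω ∈ F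
      · have : ¬ u < σ ω := fun h => hω ⟨hF', h⟩
        simp [hF', Ioc_eq_empty this]
      · simp [hF']
  set R : Ω → ℝ := fun ω => ∫ s in Ioc u (σ ω), l s ω ∂lebesgue with hR
  have hRη (ω) : R ω = (η ω (Ioc u (σ ω))).toReal := (hηr ω).symm
  have hνD : (fun ω => ν ω ({s | (s, ω) ∈ Ioi u ×ˢ F} ∩ Ioc 0 (σ ω))) =
      D.indicator fun ω => ENNReal.ofReal (n (σ ω) ω - n u ω) := by
    ext ω
    rw [hsec]
    by_cases hω : ω ∈ D <;> simp [hω, hν]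
  have hηD : (fun ω => η ω ({s | (s, ω) ∈ Ioi u ×ˢ F} ∩ Ioc 0 (σ ω))) =
      D.indicator fun ω => ENNReal.ofReal (R ω) := by
    ext ω
    rw [hsec]
    by_cases hω : ω ∈ D
    · rw [indicator_of_mem hω, indicator_of_mem hω, hRη, ENNReal.ofReal_toReal]
      exact ne_top_of_le_ne_top (hηfin ω) (measure_mono (Ioc_subset_Ioc_left zero_le))
    · simp [hω]
  obtain ⟨hYσ, -⟩ := integral_stopped_of_cadlag_martingale hY hc hσ hk
  have hzero : ∫ ω in D, (Y (σ ω) ω - Y u ω) ∂P = 0 :=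
    setIntegral_increment_eq_zero hY hc hσ hk hDu fun ω hω => hω.2
  have hR0 (ω) : 0 ≤ R ω := integral_nonneg fun s => hl0 s ω
  have hRint : IntegrableOn R D P := by
    refine Measure.integrableOn_of_bounded (M := (ENNReal.ofReal C * k).toReal)
      (measure_ne_top _ _) ?_ (ae_of_all _ fun ω => ?_)
    · have h1 := (measurable_densityMeasure_strip hl hσm (A := Ioi u ×ˢ univ)
        (measurableSet_Ioi.prod .univ)).ennreal_toReal
      simp_rw [rectangle_section] at h1
      have h2 : R = fun ω => (densityMeasure (fun s => l s ω)
          {s | ω ∈ univ ∧ s ∈ Ioc u (σ ω)}).toReal := by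
        ext ω
        rw [hRη]
        simp only [mem_univ, true_and]
        rfl
      rw [h2]
      exact h1.aestronglyMeasurable
    · rw [Real.norm_of_nonneg (hR0 ω), hRη]
      exact ENNReal.toReal_mono (ENNReal.mul_ne_top ENNReal.ofReal_ne_top ENNReal.coe_ne_top)
        ((measure_mono (Ioc_subset_Ioc_left zero_le)).trans (hηbd ω))
  have hYint : IntegrableOn (fun ω => Y (σ ω) ω - Y u ω) D P :=
    (hYσ.sub (hY.integrable u)).integrableOn
  have hdec : ∀ ω ∈ D, n (σ ω) ω - n u ω = (Y (σ ω) ω - Y u ω) + R ω := by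
    intro ω hω
    have h0 : 0 < σ ω := zero_le.trans_lt hω.2
    have hle : u ≤ σ ω := le_of_lt hω.2
    have hlI : IntegrableOn (fun s => l s ω) (Ioc 0 (σ ω)) lebesgue :=
      Measure.integrableOn_of_bounded (lebesgue_Ioc_ne_top _ _) (hlω ω).aestronglyMeasurable
        (M := C) (ae_restrict_of_forall_mem measurableSet_Ioc fun s hs => by
          rw [Real.norm_of_nonneg (hl0 s ω)]
          exact hC ω s hs)
    rw [hYn ω h0 _ le_rfl, hYn ω h0 _ hle]
    have : _ = R ω := setIntegral_Ioc_sub hle hlI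
    linarith
  have hnint : IntegrableOn (fun ω => n (σ ω) ω - n u ω) D P :=
    (hYint.add hRint).congr_fun (fun ω hω => (hdec ω hω).symm) hDm
  have hnR : ∫ ω in D, (n (σ ω) ω - n u ω) ∂P = ∫ ω in D, R ω ∂P := by
    rw [setIntegral_congr_fun hDm hdec, integral_add hYint hRint, hzero, zero_add]
  have hn0 : ∀ᵐ ω ∂P.restrict D, 0 ≤ n (σ ω) ω - n u ω :=
    ae_restrict_of_forall_mem hDm fun ω hω => sub_nonneg.2 (hn ω (le_of_lt hω.2))
  constructor
  · rw [hνD, aemeasurable_indicator_iff hDm]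
    exact hnint.aestronglyMeasurable.aemeasurable.ennreal_ofReal
  · rw [hνD, hηD, lintegral_indicator hDm, lintegral_indicator hDm,
      ← ofReal_integral_eq_lintegral_ofReal hnint hn0,
      ← ofReal_integral_eq_lintegral_ofReal hRint (ae_of_all _ hR0), hnR]

/-- The expected number of jumps in a predictable set before a bounded stopping time `σ` is the
expected mass which the intensity gives to this set, if the compensated process agrees up to `σ`
with a càdlàg martingale and the intensity is bounded before `σ`. -/
theorem lintegral_jumps_predictable [IsProbabilityMeasure P] {𝓕 : Filtration ℝ≥0 mΩ}
    {n l Y : ℝ≥0 → Ω → ℝ} {ν : Ω → Measure ℝ≥0} (hn : ∀ ω, Monotone fun t => n t ω)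
    (hν : ∀ ω a b, ν ω (Ioc a b) = ENNReal.ofReal (n b ω - n a ω))
    (hl0 : ∀ t ω, 0 ≤ l t ω) (hl : Measurable (Function.uncurry l))
    (hY : Martingale Y 𝓕 P) (hc : ∀ᵐ ω ∂P, IsCadlag fun t => Y t ω)
    {σ : Ω → ℝ≥0} (hσ : IsStoppingTime 𝓕 fun ω => (σ ω : WithTop ℝ≥0)) {k : ℝ≥0}
    (hk : ∀ ω, σ ω ≤ k) {C : ℝ} (hC : ∀ ω, ∀ s ∈ Ioc 0 (σ ω), l s ω ≤ C)
    (hYn : ∀ ω, 0 < σ ω → ∀ s ≤ σ ω, Y s ω = n s ω - ∫ u in Ioc 0 s, l u ω ∂lebesgue)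
    {A : Set (ℝ≥0 × Ω)} (hA : MeasurableSet[𝓕.predictable] A) :
    AEMeasurable (fun ω => ν ω ({s | (s, ω) ∈ A} ∩ Ioc 0 (σ ω))) P ∧
      ∫⁻ ω, ν ω ({s | (s, ω) ∈ A} ∩ Ioc 0 (σ ω)) ∂P =
        ∫⁻ ω, densityMeasure (fun s => l s ω) ({s | (s, ω) ∈ A} ∩ Ioc 0 (σ ω)) ∂P := by
  have hηm {A : Set (ℝ≥0 × Ω)} (hA : MeasurableSet A) :
      Measurable fun ω => densityMeasure (fun s => l s ω) ({s | (s, ω) ∈ A} ∩ Ioc 0 (σ ω)) :=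
    measurable_densityMeasure_strip hl (measurable_of_isStoppingTime hσ) hA
  have hηbd (ω) : densityMeasure (fun s => l s ω) (Ioc 0 (σ ω)) ≤ ENNReal.ofReal C * k :=
    (densityMeasure_Ioc_le (hC ω)).trans (by gcongr; exact hk ω)
  have hηfin (ω) : densityMeasure (fun s => l s ω) (Ioc 0 (σ ω)) ≠ ∞ :=
    ((hηbd ω).trans_lt (ENNReal.mul_lt_top ENNReal.ofReal_lt_top ENNReal.coe_lt_top)).ne
  have hrect (u : ℝ≥0) (F : Set Ω) (hF : MeasurableSet[𝓕 u] F) :=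
    lintegral_jumps_rectangle hn hν hl0 hl hY hc hσ hk hC hYn u hF
  have huniv : AEMeasurable (fun ω => ν ω (Ioc 0 (σ ω))) P ∧
      ∫⁻ ω, ν ω (Ioc 0 (σ ω)) ∂P = ∫⁻ ω, densityMeasure (fun s => l s ω) (Ioc 0 (σ ω)) ∂P := by
    have := hrect 0 univ MeasurableSet.univ
    have hs (ω) : {s | (s, ω) ∈ Ioi 0 ×ˢ (univ : Set Ω)} ∩ Ioc 0 (σ ω) = Ioc 0 (σ ω) := by
      ext s
      simp +contextual
    simpa only [hs] using this
  have hνfin (ω) : ν ω (Ioc 0 (σ ω)) ≠ ∞ := by rw [hν]; exact ENNReal.ofReal_ne_top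
  have hηint : ∫⁻ ω, densityMeasure (fun s => l s ω) (Ioc 0 (σ ω)) ∂P ≠ ∞ := by
    refine ((lintegral_mono hηbd).trans_lt ?_).ne
    rw [lintegral_const, measure_univ, mul_one]
    exact ENNReal.mul_lt_top ENNReal.ofReal_lt_top ENNReal.coe_lt_top
  have hsecm {A : Set (ℝ≥0 × Ω)} (hA : MeasurableSet[𝓕.predictable] A) (ω : Ω) :
      MeasurableSet {s | (s, ω) ∈ A} :=
    measurable_prodMk_right (predictable_le_prod 𝓕 _ hA)
  induction A, hA using MeasurableSpace.induction_on_inter (m := 𝓕.predictable) rfl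
    (isPiSystem_predictable 𝓕) with
  | empty => simp
  | basic t ht =>
    rcases ht with ⟨F, hF, rfl⟩ | ⟨u, F, hF, rfl⟩
    · have hs (ω) : {s : ℝ≥0 | (s, ω) ∈ ({⊥} : Set ℝ≥0) ×ˢ F} ∩ Ioc 0 (σ ω) = ∅ := by
        ext s
        simp only [mem_inter_iff, mem_ofPred_eq, mem_prod, mem_singleton_iff, mem_Ioc,
          mem_empty_iff_false, iff_false]
        rintro ⟨⟨rfl, -⟩, h, -⟩
        exact lt_irrefl _ h
      simp only [hs]
      simp
    · exact hrect u F hF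
  | compl t ht ih =>
    have hs (m : Measure ℝ≥0) (ω) (hm : m (Ioc 0 (σ ω)) ≠ ∞) :
        m ({s | (s, ω) ∈ tᶜ} ∩ Ioc 0 (σ ω)) =
          m (Ioc 0 (σ ω)) - m ({s | (s, ω) ∈ t} ∩ Ioc 0 (σ ω)) := by
      rw [← measure_sdiff inter_subset_right
        ((hsecm ht ω).inter measurableSet_Ioc).nullMeasurableSet
        (ne_top_of_le_ne_top hm (measure_mono inter_subset_right))]
      congr 1
      ext s
      simp only [mem_inter_iff, mem_ofPred_eq, mem_compl_iff, Set.mem_sdiff]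
      tauto
    have h1 (ω) := hs (ν ω) ω (hνfin ω)
    have h2 (ω) := hs (densityMeasure fun s => l s ω) ω (hηfin ω)
    simp_rw [h1, h2]
    have hle (m : Measure ℝ≥0) (ω) :
        m ({s | (s, ω) ∈ t} ∩ Ioc 0 (σ ω)) ≤ m (Ioc 0 (σ ω)) := measure_mono inter_subset_right
    refine ⟨huniv.1.sub ih.1, ?_⟩
    rw [lintegral_sub' ih.1 ?_ (ae_of_all _ fun ω => hle _ ω),
      lintegral_sub' (hηm (predictable_le_prod 𝓕 _ ht)).aemeasurable ?_
        (ae_of_all _ fun ω => hle _ ω), huniv.2, ih.2]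
    · exact ne_top_of_le_ne_top hηint (lintegral_mono fun ω => hle _ ω)
    · rw [ih.2]
      exact ne_top_of_le_ne_top hηint (lintegral_mono fun ω => hle _ ω)
  | iUnion f hfd hfm ih =>
    have hs (m : Measure ℝ≥0) (ω) : m ({s | (s, ω) ∈ ⋃ j, f j} ∩ Ioc 0 (σ ω)) =
        ∑' j, m ({s | (s, ω) ∈ f j} ∩ Ioc 0 (σ ω)) := by
      rw [← measure_iUnion]
      · congr 1
        ext s
        simp
      · intro i j hij
        refine Disjoint.mono inter_subset_left inter_subset_left ?_
        exact Disjoint.preimage (fun s => (s, ω)) (hfd hij)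
      · exact fun j => (hsecm (hfm j) ω).inter measurableSet_Ioc
    simp_rw [hs]
    refine ⟨AEMeasurable.tsum fun j => (ih j).1, ?_⟩
    rw [lintegral_tsum fun j => (ih j).1,
      lintegral_tsum fun j => (hηm (predictable_le_prod 𝓕 _ (hfm j))).aemeasurable]
    exact tsum_congr fun j => (ih j).2

/-! ### Localization -/

lemma stoppedProcess_indicator_of_le {X : ℝ≥0 → Ω → ℝ} {τ : Ω → WithTop ℝ≥0} {s : ℝ≥0} {ω : Ω}
    (h0 : ⊥ < τ ω) (hs : s ≤ τ ω) :
    stoppedProcess (fun i => {ω | ⊥ < τ ω}.indicator (X i)) τ s ω = X s ω := by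
  rw [stoppedProcess_eq_of_le hs]
  exact indicator_of_mem (s := {ω | ⊥ < τ ω}) h0 _

lemma IsLocallyBounded.ae_bounded_paths {𝓕 : Filtration ℝ≥0 mΩ} {X : ℝ≥0 → Ω → ℝ}
    (hX : IsLocallyBounded 𝓕 P X) : ∀ᵐ ω ∂P, ∀ t, ∃ C, ∀ s ≤ t, |X s ω| ≤ C := by
  obtain ⟨τ, hτ, hb⟩ := hX
  filter_upwards [hτ.tendsto_top] with ω hω t
  obtain ⟨n, hn⟩ := (hω.eventually_const_lt (WithTop.coe_lt_top t)).exists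
  obtain ⟨C, hC⟩ := hb n
  refine ⟨C, fun s hs => ?_⟩
  have := hC s ω
  rwa [stoppedProcess_indicator_of_le (bot_le.trans_lt hn)
    ((WithTop.coe_le_coe.2 hs).trans hn.le)] at this

/-- The jumps of a counting process with intensity `l` avoid, almost surely, every predictable set
which is null for the intensity. -/
theorem ae_jumps_avoid_predictable [IsProbabilityMeasure P] {𝓕 : Filtration ℝ≥0 mΩ}
    {n l : ℝ≥0 → Ω → ℝ} {ν : Ω → Measure ℝ≥0} (hn : ∀ ω, Monotone fun t => n t ω)
    (hν : ∀ ω a b, ν ω (Ioc a b) = ENNReal.ofReal (n b ω - n a ω))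
    (hl0 : ∀ t ω, 0 ≤ l t ω) (hl : Measurable (Function.uncurry l))
    (hlb : IsLocallyBounded 𝓕 P l)
    (hM : IsLocalMartingale 𝓕 P fun t ω => n t ω - ∫ s in Ioc 0 t, l s ω ∂lebesgue)
    {A : Set (ℝ≥0 × Ω)} (hA : MeasurableSet[𝓕.predictable] A)
    (hnull : ∀ᵐ ω ∂P, densityMeasure (fun s => l s ω) {s | (s, ω) ∈ A} = 0) :
    ∀ᵐ ω ∂P, ν ω ({s | (s, ω) ∈ A} ∩ Ioi 0) = 0 := by
  obtain ⟨S, hS, hSb⟩ := hlb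
  obtain ⟨T, hT, hTm⟩ := hM
  -- localize both the intensity and the martingale, and make the stopping times bounded
  let ρ (j : ℕ) (ω : Ω) : WithTop ℝ≥0 := min (min (S j ω) (T j ω)) ((j : ℝ≥0) : WithTop ℝ≥0)
  have hρst (j : ℕ) : IsStoppingTime 𝓕 (ρ j) :=
    ((hS.isStoppingTime j).min (hT.isStoppingTime j)).min (isStoppingTime_const 𝓕 (j : ℝ≥0))
  have hρtop (j : ℕ) (ω : Ω) : ρ j ω ≠ ⊤ :=
    ((min_le_right _ _).trans_lt (WithTop.coe_lt_top (j : ℝ≥0))).ne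
  let σ (j : ℕ) (ω : Ω) : ℝ≥0 := (ρ j ω).untop (hρtop j ω)
  have hσρ (j : ℕ) (ω : Ω) : (σ j ω : WithTop ℝ≥0) = ρ j ω := WithTop.coe_untop _ _
  have hσst (j : ℕ) : IsStoppingTime 𝓕 fun ω => (σ j ω : WithTop ℝ≥0) := by
    simp_rw [hσρ]
    exact hρst j
  have hσS (j : ℕ) (ω : Ω) : (σ j ω : WithTop ℝ≥0) ≤ S j ω := by
    rw [hσρ]; exact (min_le_left _ _).trans (min_le_left _ _)
  have hσT (j : ℕ) (ω : Ω) : (σ j ω : WithTop ℝ≥0) ≤ T j ω := by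
    rw [hσρ]; exact (min_le_left _ _).trans (min_le_right _ _)
  have hσj (j : ℕ) (ω : Ω) : σ j ω ≤ j := by
    rw [← WithTop.coe_le_coe, hσρ]; exact min_le_right _ _
  have hbot {s : ℝ≥0} {x : WithTop ℝ≥0} (h0 : 0 < s) (hx : (s : WithTop ℝ≥0) ≤ x) : ⊥ < x :=
    lt_of_lt_of_le (bot_le.trans_lt (WithTop.coe_lt_coe.2 h0)) hx
  have hstep (j : ℕ) : ∀ᵐ ω ∂P, ν ω ({s | (s, ω) ∈ A} ∩ Ioc 0 (σ j ω)) = 0 := by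
    obtain ⟨C, hC⟩ := hSb j
    obtain ⟨hY, hc⟩ := hTm j
    obtain ⟨h1, h2⟩ := lintegral_jumps_predictable hn hν hl0 hl hY hc (hσst j) (hσj j) (C := C)
      (fun ω s hs => by
        have hsS : (s : WithTop ℝ≥0) ≤ S j ω := (WithTop.coe_le_coe.2 hs.2).trans (hσS j ω)
        have := hC s ω
        rw [stoppedProcess_indicator_of_le (hbot hs.1 hsS) hsS] at this
        exact (le_abs_self _).trans this)
      (fun ω h0 s hs => stoppedProcess_indicator_of_le (hbot h0 (hσT j ω))
        ((WithTop.coe_le_coe.2 hs).trans (hσT j ω))) hA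
    have h3 : ∫⁻ ω, densityMeasure (fun s => l s ω) ({s | (s, ω) ∈ A} ∩ Ioc 0 (σ j ω)) ∂P = 0 := by
      rw [lintegral_congr_ae (g := 0), Pi.zero_def, lintegral_zero]
      filter_upwards [hnull] with ω hω using measure_mono_null inter_subset_left hω
    rw [h3, lintegral_eq_zero_iff' h1] at h2
    exact h2
  filter_upwards [ae_all_iff.2 hstep, hS.tendsto_top, hT.tendsto_top] with ω hω hωS hωT
  have hsub : {s | (s, ω) ∈ A} ∩ Ioi 0 ⊆ ⋃ j, ({s | (s, ω) ∈ A} ∩ Ioc 0 (σ j ω)) := by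
    rintro s ⟨hsA, hs0⟩
    obtain ⟨j, ⟨hj1, hj2⟩, hj3⟩ := (((hωS.eventually_const_lt (WithTop.coe_lt_top s)).and
      (hωT.eventually_const_lt (WithTop.coe_lt_top s))).and
      (tendsto_natCast_atTop_atTop.eventually_ge_atTop s)).exists
    refine mem_iUnion.2 ⟨j, hsA, hs0, ?_⟩
    rw [← WithTop.coe_le_coe, hσρ]
    exact le_min (le_min hj1.le hj2.le) (WithTop.coe_le_coe.2 hj3)
  exact measure_mono_null hsub (measure_iUnion_null hω)

/-! ### The change of measure -/

lemma isEquivProbability_changedMeasure [IsProbabilityMeasure P] {D : Ω → ℝ} (hD : Integrable D P)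
    (hD1 : ∫ ω, D ω ∂P = 1) (hpos : ∀ᵐ ω ∂P, 0 < D ω) :
    IsEquivProbability (changedMeasure P D) P := by
  refine ⟨⟨?_⟩, withDensity_absolutelyContinuous _ _, ?_⟩
  · rw [changedMeasure, withDensity_apply _ .univ, Measure.restrict_univ,
      ← ofReal_integral_eq_lintegral_ofReal hD (hpos.mono fun _ h => h.le), hD1, ENNReal.ofReal_one]
  · refine withDensity_absolutelyContinuous' hD.aestronglyMeasurable.aemeasurable.ennreal_ofReal ?_
    filter_upwards [hpos] with ω hω using (ENNReal.ofReal_pos.2 hω).ne'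

lemma integral_eq_integral_zero [IsProbabilityMeasure P] {𝓕 : Filtration ℝ≥0 mΩ}
    {Z : ℝ≥0 → Ω → ℝ} (hZ : Martingale Z 𝓕 P) (t : ℝ≥0) :
    ∫ ω, Z t ω ∂P = ∫ ω, Z 0 ω ∂P := by
  simpa using (hZ.setIntegral_eq (zero_le (a := t)) MeasurableSet.univ).symm

/-- The positivity of the exponential: the factors `γ = mu / lam` do not vanish at the jumps, since
the predictable set where `γ` vanishes has Lebesgue-null sections. -/
theorem exponential_pos [IsProbabilityMeasure P] {𝓕 : Filtration ℝ≥0 mΩ}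
    {d : ℕ} {N lam mu : Fin d → ℝ≥0 → Ω → ℝ} (hN : IsNonexplosiveCountingProcess 𝓕 N)
    (hlam : IsNonnegPredictableLocallyBounded 𝓕 P lam) (hint : HasIntensity 𝓕 P N lam)
    (hmu : IsNonnegPredictableLocallyBounded 𝓕 P mu) (hcomp : IsCompatible 𝓕 P lam mu)
    (hzero : ∀ i, ∀ᵐ ω ∂P, lebesgue {t : ℝ≥0 | mu i t ω = 0} = 0)
    {Z : ℝ≥0 → Ω → ℝ} (hZ : IsDoleansDadeExponential 𝓕 P (integralHM N lam mu) Z) :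
    ∀ᵐ ω ∂P, ∀ t, 0 < Z t ω := by
  choose ν hν hνj hνl hmono using fun i ω => exists_jump_measure (hN.cadlag i ω)
    (hN.const_right i ω) (hN.const_left i ω) (hN.jump_size i ω)
  have hlm (i) : Measurable[𝓕.predictable] (Function.uncurry (lam i)) :=
    (hlam.predictable i).measurable
  have hmm (i) : Measurable[𝓕.predictable] (Function.uncurry (mu i)) :=
    (hmu.predictable i).measurable
  have hrm (i) : Measurable[𝓕.predictable] (Function.uncurry (ratio lam mu i)) := by
    have h1 : MeasurableSet[𝓕.predictable]
        {p : ℝ≥0 × Ω | Function.uncurry (mu i) p = 0 ∧ Function.uncurry (lam i) p = 0} :=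
      MeasurableSet.inter (hmm i (measurableSet_singleton 0)) (hlm i (measurableSet_singleton 0))
    classical
    have h2 : Measurable[𝓕.predictable] fun p : ℝ≥0 × Ω =>
        if Function.uncurry (mu i) p = 0 ∧ Function.uncurry (lam i) p = 0 then (1 : ℝ)
        else Function.uncurry (mu i) p / Function.uncurry (lam i) p :=
      Measurable.ite h1 measurable_const ((hmm i).div (hlm i))
    convert h2 using 1
    ext p
    simp only [Function.uncurry, ratio]
    congr
  have hr0 (i t ω) : 0 ≤ ratio lam mu i t ω := by
    rw [ratio]
    split_ifs
    · exact zero_le_one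
    · exact div_nonneg (hmu.nonneg i t ω) (hlam.nonneg i t ω)
  have hsection {f : ℝ≥0 → Ω → ℝ} (hf : Measurable[𝓕.predictable] (Function.uncurry f)) (ω : Ω) :
      Measurable fun s => f s ω :=
    (hf.mono (predictable_le_prod 𝓕) le_rfl).comp measurable_prodMk_right
  have hvanish (i) : ∀ᵐ ω ∂P, ν i ω ({s | ratio lam mu i s ω = 0} ∩ Ioi 0) = 0 := by
    refine ae_jumps_avoid_predictable (A := {p | ratio lam mu i p.1 p.2 = 0}) (hmono i) (hν i)
      (hlam.nonneg i) ((hlm i).mono (predictable_le_prod 𝓕) le_rfl) (hlam.locallyBounded i)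
      (hint i) (hrm i (measurableSet_singleton 0)) ?_
    filter_upwards [hzero i] with ω hω
    refine withDensity_absolutelyContinuous _ _ (measure_mono_null (fun s hs => ?_) hω)
    simp only [mem_ofPred_eq, ratio] at hs ⊢
    split_ifs at hs with h
    · exact absurd hs one_ne_zero
    · rcases div_eq_zero_iff.1 hs with h | h
      · exact h
      · exact hcomp.zero_of_zero i s ω h
  filter_upwards [hZ.equation, ae_all_iff.2 hvanish,
    ae_all_iff.2 fun i => (hlam.locallyBounded i).ae_bounded_paths,
    ae_all_iff.2 fun i => (hcomp.locallyBounded i).ae_bounded_paths] with ω heq hv hlb hrb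
  refine exponential_pos_of_path (n := fun i t => N i t ω) (l := fun i t => lam i t ω)
    (g := fun i t => ratio lam mu i t ω) (ν := fun i => ν i ω) (fun i => hmono i ω)
    (fun i => hν i ω) (fun i => hνj i ω) (fun i => hνl i ω) (fun i => hsection (hlm i) ω) hlb
    (fun i => hsection (hrm i) ω) hrb (fun i => hN.jump_size i ω)
    (fun i j hij => hN.no_common_jumps i j hij ω) ?_ (hZ.cadlag ω) heq
  intro i t ht
  refine (hr0 i t ω).lt_of_ne' fun h0 => ?_
  have ht0 : 0 < t := by
    rcases eq_zero_or_pos t with rfl | h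
    · rw [jump, leftLim_eq_of_eq_bot _ (by simp), sub_self] at ht
      exact absurd ht zero_ne_one
    · exact h
  have h1 : ν i ω {t} = 0 :=
    measure_mono_null (by rintro s rfl; exact ⟨h0, ht0⟩) (hv i)
  have h2 := hνj i ω t
  rw [Measure.real, h1, ht] at h2
  simp at h2

end CountingExp

theorem lemma2p3 {Ω : Type*} {mΩ : MeasurableSpace Ω} (P : Measure Ω) [IsProbabilityMeasure P]
    (𝓕 : Filtration ℝ≥0 mΩ) (h𝓕 : CountingExp.UsualConditions 𝓕 P)
    (d : ℕ) (N lam mu : Fin d → ℝ≥0 → Ω → ℝ)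
    (hN : CountingExp.IsNonexplosiveCountingProcess 𝓕 N)
    (hlam : CountingExp.IsNonnegPredictableLocallyBounded 𝓕 P lam)
    (hint : CountingExp.HasIntensity 𝓕 P N lam)
    (hmu : CountingExp.IsNonnegPredictableLocallyBounded 𝓕 P mu)
    (hcomp : CountingExp.IsCompatible 𝓕 P lam mu)
    (hzero : ∀ i, ∀ᵐ ω ∂P, CountingExp.lebesgue {t : ℝ≥0 | mu i t ω = 0} = 0)
    (Z : ℝ≥0 → Ω → ℝ)
    (hZ : CountingExp.IsDoleansDadeExponential 𝓕 P (CountingExp.integralHM N lam mu) Z) :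
    (∀ᵐ ω ∂P, ∀ t, 0 < Z t ω) ∧
    (∀ T : Ω → WithTop ℝ≥0, IsStoppingTime 𝓕 T → (∀ᵐ ω ∂P, T ω < ⊤) →
      Martingale (stoppedProcess Z T) 𝓕 P → UniformIntegrable (stoppedProcess Z T) 1 P →
      CountingExp.IsEquivProbability (CountingExp.changedMeasure P (stoppedValue Z T)) P) ∧
    (Martingale Z 𝓕 P → ∀ t,
      CountingExp.IsEquivProbability (CountingExp.changedMeasure P (Z t)) P) := by
  have hpos : ∀ᵐ ω ∂P, ∀ t, 0 < Z t ω :=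
    CountingExp.exponential_pos hN hlam hint hmu hcomp hzero hZ
  have hZ0 : ∀ᵐ ω ∂P, Z 0 ω = 1 := by
    filter_upwards [hZ.equation] with ω hω
    rw [hω 0, CountingExp.stieltjesIntegral]
    simp
  have hone {Y : Ω → ℝ} (hY : Y =ᵐ[P] Z 0) : ∫ ω, Y ω ∂P = 1 := by
    rw [integral_congr_ae (hY.trans hZ0)]
    simp
  refine ⟨hpos, fun T _ hTfin hmart hUI => ?_, fun hmart t => ?_⟩
  · have hlim : ∀ᵐ ω ∂P, Tendsto (fun j : ℕ => stoppedProcess Z T (j : ℝ≥0) ω) atTop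
        (𝓝 (stoppedValue Z T ω)) := by
      filter_upwards [hTfin] with ω hω
      lift T ω to ℝ≥0 using hω.ne with r hr
      refine tendsto_const_nhds.congr' ?_
      filter_upwards [tendsto_natCast_atTop_atTop.eventually_ge_atTop r] with j hj
      rw [stoppedProcess_eq_of_ge (by rw [← hr]; exact WithTop.coe_le_coe.2 hj), stoppedValue]
    have hUI' : UniformIntegrable (fun j : ℕ => stoppedProcess Z T (j : ℝ≥0)) 1 P := by
      refine ⟨fun j => hUI.1 _, fun ε hε => ?_, ?_⟩
      · obtain ⟨δ, hδ, h⟩ := hUI.2.1 hε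
        exact ⟨δ, hδ, fun j => h _⟩
      · obtain ⟨C, hC⟩ := hUI.2.2
        exact ⟨C, fun j => hC _⟩
    obtain ⟨h1, h2⟩ := CountingExp.tendsto_integral_of_uniformIntegrable hUI' hlim
    refine CountingExp.isEquivProbability_changedMeasure h1 (tendsto_nhds_unique h2
      (tendsto_const_nhds.congr fun j => ?_)) (hpos.mono fun ω hω => hω _)
    rw [CountingExp.integral_eq_integral_zero hmart, hone]
    filter_upwards with ω
    exact stoppedProcess_eq_of_le bot_le
  · refine CountingExp.isEquivProbability_changedMeasure (hmart.integrable t) ?_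
      (hpos.mono fun ω hω => hω t)
    rw [CountingExp.integral_eq_integral_zero hmart, hone EventuallyEq.rfl]
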